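/- Let $n\in\mathbb N_0$, $\mathbb T^n=(\mathbb R/\mathbb Z)^n$ with normalized Haar measure $dx$, and write $|k|$ for the Euclidean length of $k\in\mathbb Z^n$, $|\alpha|=\alpha_1+\dots+\alpha_n$ for multi-indices, $\Delta_{k_j}f(k)=f(k+e_j)-f(k)$, $\Delta_k^\alpha=\Delta_{k_1}^{\alpha_1}\cdots\Delta_{k_n}^{\alpha_n}$, $k^\gamma=k_1^{\gamma_1}\cdots k_n^{\gamma_n}$, $D_{x_j}=\frac1{2\pi i}\frac{\partial}{\partial x_j}$, $D_{x_j}^{(\ell)}=\prod_{i=0}^{\ell-1}(D_{x_j}-i)$ (so $D_{x_j}^{(0)}=I$), and $D_x^{(\beta)}=D_{x_1}^{(\beta_1)}\cdots D_{x_n}^{(\beta_n)}$. Let $\Lambda:\mathbb Z^n\to\mathbb R$ be a weight function: there are constants $0<\mu_0\le\mu_1\le\mu$ and $C_0,C_1>0$ with $C_0(1+|k|)^{\mu_0}\le\Lambda(k)\le C_1(1+|k|)^{\mu_1}$ for all $k$, and for all $\alpha\in\mathbb N_0^n$, $\gamma\in\{0,1\}^n$ there is $C_{\alpha,\gamma}>0$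 with $|k^\gamma\Delta_k^{\alpha+\gamma}\Lambda(k)|\le C_{\alpha,\gamma}\Lambda(k)^{1-|\alpha|/\mu}$ for all $k$. Let $m\in\mathbb R$ and $0<\rho\le 1/\mu$. The class $S^m_{\rho,\Lambda}$ consists of the functions $\sigma:\mathbb Z^n\times\mathbb T^n\to\mathbb C$, smooth in $x$ for every $k$, such that for all $\alpha,\beta\in\mathbb N_0^n$ there is $C_{\alpha,\beta}>0$ with $$|D_x^{(\beta)}\Delta_k^\alpha\sigma(k,x)|\le C_{\alpha,\beta}\,\Lambda(k)^{m-\rho|\alpha|}\qquad\text{for all }(k,x).$$ The class $M^m_{\rho,\Lambda}$ consists of the $\sigma$, smooth in $x$ for every $k$, such that $k^\gamma\Delta_k^\gamma\sigma(k,x)\in S^m_{\rho,\Lambda}$ for all $\gamma\in\{0,1\}^n$. A symbol $\sigma\in M^m_{\rho,\Lambda}$ is $M$-elliptic if there are $C,R>0$ with $|\sigma(k,x)|\ge C\Lambda(k)^m$ for all $x\in\mathbb T^n$ and all $k$ with $|k|\ge R$. Let $\mathcal S(\mathbb Z^n)$ be the space of functions $\varphi:\mathbb Z^n\to\mathbb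 C$ such that for every $N$ there is $C$ with $|\varphi(k)|\le C(1+|k|)^{-N}$ for all $k$. For $\varphi\in\mathcal S(\mathbb Z^n)$ put $\widehat \varphi(x)=\sum_k e^{-2\pi i k\cdot x}\varphi(k)$ and $$T_\sigma \varphi(k)=\int_{\mathbb T^n}e^{2\pi i k\cdot x}\sigma(k,x)\widehat \varphi(x)\,dx .$$ Theorem. Let $\sigma\in M^m_{\rho,\Lambda}$ be $M$-elliptic. Then $T_\sigma$ maps $\mathcal S(\mathbb Z^n)$ into $\ell^2(\mathbb Z^n)$. Regard it as an operator in $\ell^2(\mathbb Z^n)$ with domain $\mathcal S(\mathbb Z^n)$; the domain of its adjoint $T_\sigma^*$ contains $\mathcal S(\mathbb Z^n)$. The following relations define linear operators $T_{\sigma,0}$ (minimal) and $T_{\sigma,1}$ (maximal) in $\ell^2(\mathbb Z^n)$, that is, in each of them $f$ is determined by $g$: * $g\in\mathrm{Dom}(T_{\sigma,0})$ and $T_{\sigma,0}g=f$ if and only if there are $\varphi_j\in\mathcal S(\mathbb Z^n)$ with $\varphi_j\to g$ and $T_\sigma\varphi_j\to f$ in $\ell^2(\mathbb Z^n)$; *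 $g\in\mathrm{Dom}(T_{\sigma,1})$ and $T_{\sigma,1}g=f$ if and only if $\langle g,T_\sigma^*\psi\rangle=\langle f,\psi\rangle$ for all $\psi\in\mathcal S(\mathbb Z^n)$. Moreover $T_{\sigma,0}=T_{\sigma,1}$: the two operators have the same domain and agree on it. -/

import Mathlib

open MeasureTheory Filter Topology
open scoped ContDiff

noncomputable section

namespace LatticePDO

/-! ## The lattice, difference operators, weights -/

/-- The lattice `ℤⁿ`. -/
abbrev Lattice (n : ℕ) : Type := Fin n → ℤ

/-- The torus `𝕋ⁿ = (ℝ/ℤ)ⁿ`. -/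
abbrev Torus (n : ℕ) : Type := UnitAddTorus (Fin n)

/-- The Euclidean length `|k|` of a lattice point. -/
def latticeNorm {n : ℕ} (k : Lattice n) : ℝ := √(∑ j, (k j : ℝ) ^ 2)

/-- The length `|α| = α₁ + ⋯ + αₙ` of a multi-index. -/
def multiLength {n : ℕ} (α : Fin n → ℕ) : ℕ := ∑ j, α j

/-- The composition `A₁ ∘ A₂ ∘ ⋯ ∘ Aₙ` of a finite family of self-maps. -/
def composeAll {X : Type*} {n : ℕ} (A : Fin n → X → X) : X → X :=
  (List.ofFn A).foldr (fun f g => f ∘ g) id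

/-- `Δ_k^α = Δ_{k₁}^{α₁} ⋯ Δ_{kₙ}^{αₙ}`, where `Δ_{k_j} f(k) = f(k + e_j) - f(k)`. -/
def latticeDiff {n : ℕ} {G : Type*} [AddCommGroup G] (α : Fin n → ℕ) :
    (Lattice n → G) → (Lattice n → G) :=
  composeAll fun j => (fwdDiff (Pi.single j (1 : ℤ)))^[α j]

/-- The monomial `k^γ = k₁^{γ₁} ⋯ kₙ^{γₙ}`. -/
def latticeMonomial {n : ℕ} (γ : Fin n → ℕ) (k : Lattice n) : ℤ := ∏ j, k j ^ γ j

/-- `Λ` is a weight function on `ℤⁿ` with parameter `μ`. -/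
structure IsWeight {n : ℕ} (μ : ℝ) (Λ : Lattice n → ℝ) : Prop where
  growth : ∃ μ₀ μ₁ C₀ C₁ : ℝ, 0 < μ₀ ∧ μ₀ ≤ μ₁ ∧ μ₁ ≤ μ ∧ 0 < C₀ ∧ 0 < C₁ ∧
    ∀ k, C₀ * (1 + latticeNorm k) ^ μ₀ ≤ Λ k ∧ Λ k ≤ C₁ * (1 + latticeNorm k) ^ μ₁
  diff_le : ∀ α γ : Fin n → ℕ, (∀ j, γ j ≤ 1) → ∃ C : ℝ, 0 < C ∧
    ∀ k, |(latticeMonomial γ k : ℝ) * latticeDiff (α + γ) Λ k| ≤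
      C * Λ k ^ (1 - 1 / μ * (multiLength α : ℝ))

/-! ## Functions on the torus -/

/-- `F ∈ C^∞(𝕋ⁿ)`: the periodic function on `ℝⁿ` that `F` induces is smooth. -/
def TorusSmooth {n : ℕ} (F : Torus n → ℂ) : Prop :=
  ContDiff ℝ ∞ fun y : Fin n → ℝ => F fun j => (y j : UnitAddCircle)

/-- `D_{x_j} = (2πi)⁻¹ ∂/∂x_j`. -/
def torusD {n : ℕ} (j : Fin n) (F : Torus n → ℂ) : Torus n → ℂ := fun x =>
  (2 * Real.pi * Complex.I)⁻¹ *
    deriv (fun t : ℝ => F (x + Pi.single j (t : UnitAddCircle))) 0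

/-- `D_{x_j}^{(ℓ)} = D_{x_j} (D_{x_j} - 1) ⋯ (D_{x_j} - (ℓ - 1))`, with `D_{x_j}^{(0)} = I`. -/
def torusDFalling {n : ℕ} (j : Fin n) : ℕ → (Torus n → ℂ) → (Torus n → ℂ)
  | 0 => fun F => F
  | ℓ + 1 => fun F x =>
      torusD j (torusDFalling j ℓ F) x - (ℓ : ℂ) * torusDFalling j ℓ F x

/-- `D_x^{(β)} = D_{x₁}^{(β₁)} ⋯ D_{xₙ}^{(βₙ)}`. -/
def torusDMulti {n : ℕ} (β : Fin n → ℕ) : (Torus n → ℂ) → (Torus n → ℂ) :=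
  composeAll fun j => torusDFalling j (β j)

/-- The normalized Haar measure `dx` on `𝕋ⁿ`. -/
def torusMeasure (n : ℕ) : Measure (Torus n) :=
  Measure.pi fun _ => (AddCircle.haarAddCircle : Measure UnitAddCircle)

instance torusMeasure_isProbabilityMeasure (n : ℕ) : IsProbabilityMeasure (torusMeasure n) := by
  unfold torusMeasure; infer_instance

theorem TorusSmooth.continuous {n : ℕ} {F : Torus n → ℂ} (hF : TorusSmooth F) :
    Continuous F := by
  have hq : IsOpenQuotientMap
      (Pi.map fun _ : Fin n => ((↑) : ℝ → UnitAddCircle)) :=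
    IsOpenQuotientMap.piMap fun _ => QuotientAddGroup.isOpenQuotientMap_mk
  exact hq.isQuotientMap.continuous_iff.2 (ContDiff.continuous hF)

/-! ## Symbol classes -/

/-- `σ ∈ S^m_{ρ,Λ}(ℤⁿ × 𝕋ⁿ)`. -/
structure IsTaylorSymbol {n : ℕ} (ρ : ℝ) (Λ : Lattice n → ℝ) (m : ℝ)
    (σ : Lattice n → Torus n → ℂ) : Prop where
  smooth : ∀ k, TorusSmooth (σ k)
  bound : ∀ α β : Fin n → ℕ, ∃ C : ℝ, 0 < C ∧ ∀ k x,
    ‖torusDMulti β (fun y => latticeDiff α (fun l => σ l y) k) x‖ ≤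
      C * Λ k ^ (m - ρ * (multiLength α : ℝ))

/-- `σ ∈ M^m_{ρ,Λ}(ℤⁿ × 𝕋ⁿ)`. -/
structure IsMSymbol {n : ℕ} (ρ : ℝ) (Λ : Lattice n → ℝ) (m : ℝ)
    (σ : Lattice n → Torus n → ℂ) : Prop where
  smooth : ∀ k, TorusSmooth (σ k)
  mem : ∀ γ : Fin n → ℕ, (∀ j, γ j ≤ 1) →
    IsTaylorSymbol ρ Λ m fun k x =>
      (latticeMonomial γ k : ℂ) * latticeDiff γ (fun l => σ l x) k

/-- The lower bound in the definition of `M`-ellipticity (of order `m`). -/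
def IsMElliptic {n : ℕ} (Λ : Lattice n → ℝ) (m : ℝ) (σ : Lattice n → Torus n → ℂ) : Prop :=
  ∃ C R : ℝ, 0 < C ∧ 0 < R ∧ ∀ k, R ≤ latticeNorm k → ∀ x, C * Λ k ^ m ≤ ‖σ k x‖

/-! ## The space `ℓ²(ℤⁿ)`, rapidly decreasing functions, the Fourier transform -/

/-- `ℓ²(ℤⁿ)`. -/
abbrev L2 (n : ℕ) : Type := lp (fun _ : Lattice n => ℂ) 2

/-- The defining property of `𝒮(ℤⁿ)`: decay faster than every power of `1 + |k|`. -/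
def IsRapidlyDecreasing {n : ℕ} (φ : Lattice n → ℂ) : Prop :=
  ∀ N : ℕ, ∃ C : ℝ, ∀ k, ‖φ k‖ ≤ C * ((1 + latticeNorm k) ^ N)⁻¹

/-- `𝒮(ℤⁿ)` as a subspace of `ℓ²(ℤⁿ)`. -/
def schwartz (n : ℕ) : Submodule ℂ (L2 n) where
  carrier := {φ | IsRapidlyDecreasing fun k => φ k}
  zero_mem' := fun N => ⟨0, fun k => by simp⟩
  add_mem' := by
    intro φ ψ hφ hψ N
    obtain ⟨C, hC⟩ := hφ N
    obtain ⟨D, hD⟩ := hψ N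
    refine ⟨C + D, fun k => ?_⟩
    rw [add_mul]
    exact (norm_add_le _ _).trans (add_le_add (hC k) (hD k))
  smul_mem' := by
    intro c φ hφ N
    obtain ⟨C, hC⟩ := hφ N
    refine ⟨‖c‖ * C, fun k => ?_⟩
    rw [mul_assoc]
    refine (norm_smul_le c (φ k)).trans ?_
    exact mul_le_mul_of_nonneg_left (hC k) (norm_nonneg c)

/-- The Fourier transform `f̂(x) = ∑_k e^{-2πi k·x} f(k)`. -/
def latticeFourier {n : ℕ} (f : Lattice n → ℂ) (x : Torus n) : ℂ :=
  ∑' k, UnitAddTorus.mFourier (-k) x * f k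

theorem summable_prod_aux (n : ℕ) :
    Summable fun k : Lattice n => ∏ j, ((1 + |(k j : ℝ)|) ^ 2)⁻¹ := by
  have h1 : Summable fun a : ℤ => ((1 + |(a : ℝ)|) ^ 2)⁻¹ := by
    have h : Summable fun a : ℤ => 1 / |(a : ℝ)| ^ (2 : ℝ) :=
      Real.summable_abs_int_rpow (b := 2) (by norm_num) |>.congr fun a => by
        rw [Real.rpow_neg (abs_nonneg _), one_div]
    have h0 : Summable fun a : ℤ => 1 / |(a : ℝ)| ^ (2 : ℝ) + if a = 0 then (1 : ℝ) else 0 :=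
      h.add (summable_of_hasFiniteSupport
        ((Set.finite_singleton (0 : ℤ)).subset fun a ha => by by_contra h'; simp_all))
    refine Summable.of_nonneg_of_le (fun a => by positivity) (fun a => ?_) h0
    by_cases ha : a = 0
    · simp [ha]
    · have : 0 < |(a : ℝ)| := abs_pos.2 (by exact_mod_cast ha)
      rw [if_neg ha, add_zero, one_div]
      refine inv_anti₀ (by positivity) ?_
      rw [Real.rpow_two]
      gcongr
      linarith
  induction n with
  | zero => exact Summable.of_finite
  | succ n ih =>
    have h2 := h1.mul_of_nonneg ih (fun a => by positivity) (fun k => by positivity)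
    refine ((Fin.consEquiv fun _ : Fin (n + 1) => ℤ).summable_iff).1 (h2.congr fun p => ?_)
    simp [Function.comp, Fin.prod_univ_succ, Fin.consEquiv, mul_comm]

theorem IsRapidlyDecreasing.summable {n : ℕ} {φ : Lattice n → ℂ}
    (hφ : IsRapidlyDecreasing φ) : Summable fun k => ‖φ k‖ := by
  obtain ⟨C, hC⟩ := hφ (∑ _j : Fin n, 2)
  refine Summable.of_nonneg_of_le (fun k => norm_nonneg _) (fun k => ?_)
    ((summable_prod_aux n).mul_left |C|)
  refine (hC k).trans ?_
  refine mul_le_mul (le_abs_self C) ?_ (inv_nonneg.2 (pow_nonneg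
    (add_nonneg zero_le_one (Real.sqrt_nonneg _)) _)) (abs_nonneg C)
  rw [Finset.prod_inv_distrib, ← Finset.prod_pow_eq_pow_sum]
  refine inv_anti₀ (Finset.prod_pos fun j _ => by positivity) ?_
  refine Finset.prod_le_prod (fun j _ => by positivity) fun j _ => ?_
  gcongr
  rw [latticeNorm, ← Real.sqrt_sq_eq_abs]
  exact Real.sqrt_le_sqrt (Finset.single_le_sum (f := fun i => (k i : ℝ) ^ 2)
    (fun i _ => sq_nonneg _) (Finset.mem_univ j))

theorem norm_mFourier_apply {n : ℕ} (k : Lattice n) (x : Torus n) :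
    ‖UnitAddTorus.mFourier k x‖ ≤ 1 :=
  ((UnitAddTorus.mFourier k).norm_coe_le_norm x).trans UnitAddTorus.mFourier_norm.le

theorem norm_fourierTerm_le {n : ℕ} (f : Lattice n → ℂ) (k : Lattice n) (x : Torus n) :
    ‖UnitAddTorus.mFourier (-k) x * f k‖ ≤ ‖f k‖ := by
  rw [norm_mul]
  exact mul_le_of_le_one_left (norm_nonneg _) (norm_mFourier_apply _ _)

theorem IsRapidlyDecreasing.summable_fourier {n : ℕ} {φ : Lattice n → ℂ}
    (hφ : IsRapidlyDecreasing φ) (x : Torus n) :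
    Summable fun k => UnitAddTorus.mFourier (-k) x * φ k :=
  Summable.of_norm_bounded hφ.summable fun k => norm_fourierTerm_le φ k x

theorem IsRapidlyDecreasing.continuous_fourier {n : ℕ} {φ : Lattice n → ℂ}
    (hφ : IsRapidlyDecreasing φ) : Continuous (latticeFourier φ) :=
  continuous_tsum (fun k => by fun_prop) hφ.summable fun k x => norm_fourierTerm_le φ k x

/-! ## Pseudo-differential operators on `ℓ²(ℤⁿ)` -/

/-- `(T_σ f)(k) = ∫_{𝕋ⁿ} e^{2πi k·x} σ(k, x) f̂(x) dx`. -/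
def pdoFun {n : ℕ} (σ : Lattice n → Torus n → ℂ) (f : Lattice n → ℂ) (k : Lattice n) : ℂ :=
  ∫ x, UnitAddTorus.mFourier k x * σ k x * latticeFourier f x ∂(torusMeasure n)

theorem integrable_pdo {n : ℕ} {σ : Lattice n → Torus n → ℂ} (hσ : ∀ k, TorusSmooth (σ k))
    {φ : Lattice n → ℂ} (hφ : IsRapidlyDecreasing φ) (k : Lattice n) :
    Integrable (fun x => UnitAddTorus.mFourier k x * σ k x * latticeFourier φ x)
      (torusMeasure n) := by
  have h1 := (hσ k).continuous
  have h2 := hφ.continuous_fourier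
  have h3 : Continuous fun x => UnitAddTorus.mFourier k x * σ k x * latticeFourier φ x := by
    fun_prop
  exact h3.integrable_of_hasCompactSupport (HasCompactSupport.of_compactSpace _)

theorem pdoFun_add {n : ℕ} {σ : Lattice n → Torus n → ℂ} (hσ : ∀ k, TorusSmooth (σ k))
    {φ ψ : Lattice n → ℂ} (hφ : IsRapidlyDecreasing φ) (hψ : IsRapidlyDecreasing ψ) :
    pdoFun σ (φ + ψ) = pdoFun σ φ + pdoFun σ ψ := by
  funext k
  simp only [pdoFun, Pi.add_apply]
  rw [← integral_add (integrable_pdo hσ hφ k) (integrable_pdo hσ hψ k)]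
  refine integral_congr_ae (Eventually.of_forall fun x => ?_)
  simp only [latticeFourier, Pi.add_apply, mul_add,
    (hφ.summable_fourier x).tsum_add (hψ.summable_fourier x)]

theorem pdoFun_smul {n : ℕ} (σ : Lattice n → Torus n → ℂ) (c : ℂ) (φ : Lattice n → ℂ) :
    pdoFun σ (c • φ) = c • pdoFun σ φ := by
  funext k
  simp only [pdoFun, Pi.smul_apply, smul_eq_mul]
  rw [← integral_const_mul]
  refine integral_congr_ae (Eventually.of_forall fun x => ?_)
  simp only [latticeFourier, Pi.smul_apply, smul_eq_mul, mul_left_comm _ c, tsum_mul_left]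

/-- The operator `T_σ` in `ℓ²(ℤⁿ)`, defined on those `φ ∈ 𝒮(ℤⁿ)` with `T_σ φ ∈ ℓ²(ℤⁿ)`
(for a symbol in one of the classes above these are all `φ ∈ 𝒮(ℤⁿ)`). -/
def pdo {n : ℕ} (σ : Lattice n → Torus n → ℂ) (hσ : ∀ k, TorusSmooth (σ k)) :
    L2 n →ₗ.[ℂ] L2 n where
  domain :=
    { carrier := {φ | φ ∈ schwartz n ∧ Memℓp (pdoFun σ fun k => φ k) 2}
      zero_mem' := by
        refine ⟨zero_mem _, ?_⟩
        have h : pdoFun σ (0 : Lattice n → ℂ) = 0 := by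
          simpa using pdoFun_smul σ 0 0
        exact (congrArg (fun u => Memℓp u 2) h).mpr zero_memℓp
      add_mem' := by
        rintro φ ψ ⟨hφ, hφ'⟩ ⟨hψ, hψ'⟩
        refine ⟨add_mem hφ hψ, ?_⟩
        have h := pdoFun_add hσ hφ hψ
        exact (congrArg (fun u => Memℓp u 2) h).mpr (hφ'.add hψ')
      smul_mem' := by
        rintro c φ ⟨hφ, hφ'⟩
        refine ⟨(schwartz n).smul_mem c hφ, ?_⟩
        have h := pdoFun_smul σ c (fun k => φ k)
        exact (congrArg (fun u => Memℓp u 2) h).mpr (hφ'.const_smul c) }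
  toFun :=
    { toFun := fun φ => ⟨pdoFun σ fun k => φ.1 k, φ.2.2⟩
      map_add' := fun φ ψ => Subtype.ext (pdoFun_add hσ φ.2.1 ψ.2.1)
      map_smul' := fun c φ => Subtype.ext (pdoFun_smul σ c fun k => φ.1 k) }

/-- The graph of the minimal operator `T_{σ,0}`: the pairs `(g, f)` for which there is a sequence
`φ_j` in the domain of `T_σ` with `φ_j → g` and `T_σ φ_j → f` in `ℓ²(ℤⁿ)`. -/
def minimalGraph {n : ℕ} (σ : Lattice n → Torus n → ℂ) (hσ : ∀ k, TorusSmooth (σ k)) :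
    Submodule ℂ (L2 n × L2 n) where
  carrier := {p | ∃ φ : ℕ → (pdo σ hσ).domain,
    Tendsto (fun j => (φ j : L2 n)) atTop (𝓝 p.1) ∧
    Tendsto (fun j => pdo σ hσ (φ j)) atTop (𝓝 p.2)}
  zero_mem' := ⟨fun _ => 0, by simp, by simp⟩
  add_mem' := by
    rintro p q ⟨φ, h1, h2⟩ ⟨ψ, h3, h4⟩
    refine ⟨fun j => φ j + ψ j, ?_, ?_⟩
    · simpa using h1.add h3
    · simpa [LinearPMap.map_add] using h2.add h4
  smul_mem' := by
    rintro c p ⟨φ, h1, h2⟩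
    refine ⟨fun j => c • φ j, ?_, ?_⟩
    · simpa using h1.const_smul c
    · simpa [LinearPMap.map_smul] using h2.const_smul c

/-- The graph of the maximal operator `T_{σ,1}`: the pairs `(g, f)` with
`⟨g, T_σ^* ψ⟩ = ⟨f, ψ⟩` for all `ψ ∈ 𝒮(ℤⁿ)`, where `T_σ^*` is the adjoint of `T_σ`. -/
def maximalGraph {n : ℕ} (σ : Lattice n → Torus n → ℂ) (hσ : ∀ k, TorusSmooth (σ k)) :
    Submodule ℂ (L2 n × L2 n) where
  carrier := {p | ∀ ψ : (pdo σ hσ).adjoint.domain, (ψ : L2 n) ∈ schwartz n →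
    inner ℂ p.1 ((pdo σ hσ).adjoint ψ) = inner ℂ p.2 (ψ : L2 n)}
  zero_mem' := fun ψ _ => by simp
  add_mem' := by
    intro p q hp hq ψ hψ
    simp only [Prod.fst_add, Prod.snd_add, inner_add_left, hp ψ hψ, hq ψ hψ]
  smul_mem' := by
    intro c p hp ψ hψ
    simp only [Prod.smul_fst, Prod.smul_snd, inner_smul_left, hp ψ hψ]

/-- The minimal operator `T_{σ,0}`. -/
def minimalOp {n : ℕ} (σ : Lattice n → Torus n → ℂ) (hσ : ∀ k, TorusSmooth (σ k)) :
    L2 n →ₗ.[ℂ] L2 n :=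
  (minimalGraph σ hσ).toLinearPMap

/-- The maximal operator `T_{σ,1}`. -/
def maximalOp {n : ℕ} (σ : Lattice n → Torus n → ℂ) (hσ : ∀ k, TorusSmooth (σ k)) :
    L2 n →ₗ.[ℂ] L2 n :=
  (maximalGraph σ hσ).toLinearPMap

end LatticePDO

end

noncomputable section

namespace LatticePDO

/-! ## Lattice weights -/

/-! On rapidly decreasing functions `T_σ` is a matrix: its entry at `(k, l)` is the Fourier integral
`A(k, l)` of `σ(k, ·)` at frequency `k - l` (`hasSum_pdoFun`). Integration by parts in `x` bounds
this entry by `C_N Λ(k)^m ⟨k-l⟩^{-N}` for every `N`; such a matrix is said to have order `m`. The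
difference condition on the weight makes `Λ^{1/μ}` Lipschitz, so `Λ(p) ≤ C Λ(k) ⟨p-k⟩^M`
(`IsWeight.isModerate`). Powers of `Λ` can therefore be moved across a matrix at the cost of some
off-diagonal decay, and a matrix of order `s` maps `Λ^{-t}ℓ²` into `Λ^{s-t}ℓ²`
(`HasOrder.isSobolev`).

Minimal lies inside maximal by passing to the limit in the formal adjoint identity. For the converse
let `(g, f)` be in the maximal graph. Testing against unit vectors gives `f = A g` entrywise
(`IsTaylorSymbol.hasSum_of_mem_maximalGraph`), which also makes the maximal relation single-valued.
Let `B` be the matrix of the symbol `1/σ`, cut off to `|k| ≥ R`. Replacing `σ(p, ·)` by `σ(k, ·)` in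
the product `BA` gives the identity exactly, and the error contains a difference of `σ` in the
lattice variable, which gains `Λ^{-ρ}`. Hence `BA = I + S` with `S` of order `-ρ`
(`exists_parametrix_remainder`) and `g = B f - S g`. Iterating this identity improves the regularity
of `g` by `ρ` each time, up to `Λ^m g ∈ ℓ²` (`IsTaylorSymbol.isSobolev_of_elliptic`). Finite
truncations of `g` then converge in the norm of `Λ^{-m}ℓ²`, where `A` is continuous into `ℓ²`, so
`(g, f)` lies in the minimal graph (`IsTaylorSymbol.mem_minimalGraph`). -/

/-- The `ℓ¹` length of a lattice point. -/
def latticeSize {n : ℕ} (k : Lattice n) : ℕ := ∑ j, (k j).natAbs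

theorem latticeSize_neg {n : ℕ} (k : Lattice n) : latticeSize (-k) = latticeSize k := by
  simp [latticeSize]

theorem latticeSize_zero {n : ℕ} : latticeSize (0 : Lattice n) = 0 := by simp [latticeSize]

theorem latticeSize_add_le {n : ℕ} (k l : Lattice n) :
    latticeSize (k + l) ≤ latticeSize k + latticeSize l := by
  simp only [latticeSize, ← Finset.sum_add_distrib]
  exact Finset.sum_le_sum fun j _ => Int.natAbs_add_le _ _

/-- The weight `1 + ∑ |k_j|`. -/
def bracket {n : ℕ} (k : Lattice n) : ℝ := 1 + latticeSize k

theorem one_le_bracket {n : ℕ} (k : Lattice n) : 1 ≤ bracket k := by simp [bracket]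

theorem bracket_pos {n : ℕ} (k : Lattice n) : 0 < bracket k := zero_lt_one.trans_le (one_le_bracket k)

theorem bracket_neg {n : ℕ} (k : Lattice n) : bracket (-k) = bracket k := by
  simp [bracket, latticeSize_neg]

theorem bracket_sub_comm {n : ℕ} (k l : Lattice n) : bracket (k - l) = bracket (l - k) := by
  rw [← bracket_neg, neg_sub]

theorem bracket_zero {n : ℕ} : bracket (0 : Lattice n) = 1 := by simp [bracket, latticeSize_zero]

theorem bracket_add_le {n : ℕ} (k l : Lattice n) : bracket (k + l) ≤ bracket k * bracket l := by
  have h : (latticeSize (k + l) : ℝ) ≤ latticeSize k + latticeSize l := by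
    exact_mod_cast latticeSize_add_le k l
  have : (0 : ℝ) ≤ latticeSize k * latticeSize l := by positivity
  simp only [bracket]
  linarith

/-- Every `1 + |k_j|` is at most `bracket k`, so two powers per coordinate reduce the claim to a
product of convergent one-dimensional series. -/
theorem summable_bracket (n : ℕ) : Summable fun k : Lattice n => (bracket k ^ (2 * n))⁻¹ := by
  refine Summable.of_nonneg_of_le (fun k => inv_nonneg.2 (pow_nonneg (bracket_pos k).le _))
    (fun k => ?_) (summable_prod_aux n)
  rw [Finset.prod_inv_distrib]
  refine inv_anti₀ (Finset.prod_pos fun j _ => by positivity) ?_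
  calc ∏ j, (1 + |(k j : ℝ)|) ^ 2 ≤ ∏ _j : Fin n, bracket k ^ 2 := by
        refine Finset.prod_le_prod (fun j _ => by positivity) fun j _ => ?_
        gcongr
        have : (k j).natAbs ≤ latticeSize k :=
          Finset.single_le_sum (f := fun i => (k i).natAbs) (fun _ _ => Nat.zero_le _)
            (Finset.mem_univ j)
        have h2 : ((k j).natAbs : ℝ) ≤ latticeSize k := by exact_mod_cast this
        rw [bracket]
        rw [Nat.cast_natAbs] at h2
        push_cast at h2
        linarith
    _ = bracket k ^ (2 * n) := by simp [pow_mul]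

theorem bracket_le_latticeNorm {n : ℕ} (k : Lattice n) :
    bracket k ≤ (1 + n) * (1 + latticeNorm k) := by
  have h : ∀ j, ((k j).natAbs : ℝ) ≤ latticeNorm k := fun j => by
    rw [Nat.cast_natAbs, latticeNorm]
    push_cast
    rw [← Real.sqrt_sq_eq_abs]
    exact Real.sqrt_le_sqrt (Finset.single_le_sum (f := fun i => (k i : ℝ) ^ 2)
      (fun i _ => sq_nonneg _) (Finset.mem_univ j))
  have h2 : (latticeSize k : ℝ) ≤ n * latticeNorm k := by
    rw [latticeSize]
    push_cast
    refine (Finset.sum_le_sum fun j _ => h j).trans ?_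
    simp
  have h3 : 0 ≤ latticeNorm k := Real.sqrt_nonneg _
  have h4 : (0 : ℝ) ≤ n := by positivity
  rw [bracket]
  nlinarith

/-- Walk from `p` to `k` by unit steps, each lowering the `ℓ¹` distance to `k` by one. The path
stays in the ball where the step bound is assumed. -/
theorem norm_sub_le_of_step {n : ℕ} {E : Type*} [SeminormedAddCommGroup E] (G : Lattice n → E)
    (k : Lattice n) (N : ℕ) (W : ℝ)
    (h : ∀ q j, latticeSize (q - k) ≤ N → ‖G (q + Pi.single j 1) - G q‖ ≤ W) (p : Lattice n)
    (hp : latticeSize (p - k) ≤ N) : ‖G p - G k‖ ≤ latticeSize (p - k) * W := by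
  obtain ⟨M, hM⟩ : ∃ M, latticeSize (p - k) = M := ⟨_, rfl⟩
  induction M generalizing p with
  | zero =>
    have : p = k := by
      funext j
      rw [latticeSize, Finset.sum_eq_zero_iff] at hM
      have := hM j (Finset.mem_univ j)
      simp only [Pi.sub_apply] at this
      omega
    simp [this, latticeSize_zero]
  | succ M ih =>
    obtain ⟨j, hj⟩ : ∃ j, (p - k) j ≠ 0 := by
      by_contra! h0
      have : p - k = 0 := funext h0
      rw [this, latticeSize_zero] at hM
      omega
    have key : ∀ p' : Lattice n, (∀ i, i ≠ j → p' i = p i) →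
        ((p' - k) j).natAbs + 1 = ((p - k) j).natAbs → latticeSize (p' - k) = M := by
      intro p' h1 h2
      have h3 : latticeSize (p' - k) + 1 = latticeSize (p - k) := by
        simp only [latticeSize]
        rw [← Finset.add_sum_erase _ _ (Finset.mem_univ j),
          ← Finset.add_sum_erase _ (fun j => ((p - k) j).natAbs) (Finset.mem_univ j), ← h2]
        have : ∑ x ∈ Finset.univ.erase j, ((p' - k) x).natAbs =
            ∑ x ∈ Finset.univ.erase j, ((p - k) x).natAbs := by
          refine Finset.sum_congr rfl fun x hx => ?_
          simp [h1 x (Finset.ne_of_mem_erase hx)]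
        omega
      omega
    -- The sign of the coordinate decides whether the forward difference is based at `p` or at `p -
    -- e_j`; both points lie in the ball.
    rcases lt_or_gt_of_ne hj with hneg | hpos
    · have h1 := key (p + Pi.single j 1) (fun i hi => by simp [hi])
        (by simp only [Pi.sub_apply, Pi.add_apply, Pi.single_eq_same] at hneg ⊢; omega)
      have h2 := ih _ (by omega) h1
      have h3 := h p j hp
      rw [h1] at h2
      rw [hM]
      calc ‖G p - G k‖ = ‖(G (p + Pi.single j 1) - G k) - (G (p + Pi.single j 1) - G p)‖ := by
            congr 1; abel
        _ ≤ M * W + W := (norm_sub_le _ _).trans (add_le_add h2 h3)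
        _ = _ := by push_cast; ring
    · have h1 := key (p - Pi.single j 1) (fun i hi => by simp [hi])
        (by simp only [Pi.sub_apply, Pi.single_eq_same] at hpos ⊢; omega)
      have h2 := ih _ (by omega) h1
      have h3 := h (p - Pi.single j 1) j (by omega)
      rw [sub_add_cancel] at h3
      rw [h1] at h2
      rw [hM]
      calc ‖G p - G k‖ = ‖(G p - G (p - Pi.single j 1)) + (G (p - Pi.single j 1) - G k)‖ := by
            congr 1; abel
        _ ≤ W + M * W := (norm_add_le _ _).trans (add_le_add h3 h2)
        _ = _ := by push_cast; ring

/-- A weight that is bounded below by a positive constant and varies at most polynomially. -/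
structure IsModerate {n : ℕ} (Λ : Lattice n → ℝ) : Prop where
  lower : ∃ c : ℝ, 0 < c ∧ ∀ k, c ≤ Λ k
  moderate : ∃ (C : ℝ) (M : ℕ), 0 < C ∧ ∀ k p, Λ p ≤ C * Λ k * bracket (p - k) ^ M

theorem IsModerate.pos {n : ℕ} {Λ : Lattice n → ℝ} (h : IsModerate Λ) (k : Lattice n) :
    0 < Λ k := by
  obtain ⟨c, hc, hk⟩ := h.lower
  exact hc.trans_le (hk k)

/-- For `s ≥ 0` raise the moderateness bound to the power `s`. For `s ≤ 0` use it with `k` and `p`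
exchanged, which is harmless because `bracket` is even. -/
theorem IsModerate.rpow_le {n : ℕ} {Λ : Lattice n → ℝ} (h : IsModerate Λ) (s : ℝ) :
    ∃ (C : ℝ) (M : ℕ), 0 < C ∧ ∀ k p, Λ p ^ s ≤ C * Λ k ^ s * bracket (p - k) ^ M := by
  obtain ⟨C, M, hC, hM⟩ := h.moderate
  have hb : ∀ (t : ℝ) (q : Lattice n), 0 ≤ t →
      (bracket q ^ M) ^ t ≤ bracket q ^ ⌈M * t⌉₊ := fun t q ht => by
    rw [← Real.rpow_natCast, ← Real.rpow_natCast, ← Real.rpow_mul (bracket_pos q).le]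
    exact Real.rpow_le_rpow_of_exponent_le (one_le_bracket q) (Nat.le_ceil _)
  rcases le_total 0 s with hs | hs
  · refine ⟨C ^ s, ⌈M * s⌉₊, Real.rpow_pos_of_pos hC s, fun k p => ?_⟩
    have hk := h.pos k
    have hp := h.pos p
    have hq := bracket_pos (p - k)
    calc Λ p ^ s ≤ (C * Λ k * bracket (p - k) ^ M) ^ s :=
          Real.rpow_le_rpow hp.le (hM k p) hs
      _ = C ^ s * Λ k ^ s * (bracket (p - k) ^ M) ^ s := by
          rw [Real.mul_rpow (by positivity) (by positivity), Real.mul_rpow hC.le hk.le]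
      _ ≤ _ := by gcongr; exact hb s _ hs
  · refine ⟨C ^ (-s), ⌈M * (-s)⌉₊, Real.rpow_pos_of_pos hC _, fun k p => ?_⟩
    have hk := h.pos k
    have hp := h.pos p
    have hq := bracket_pos (p - k)
    have h1 : Λ k ^ (-s) ≤ C ^ (-s) * Λ p ^ (-s) * bracket (p - k) ^ ⌈M * (-s)⌉₊ :=
      calc Λ k ^ (-s) ≤ (C * Λ p * bracket (p - k) ^ M) ^ (-s) := by
            refine Real.rpow_le_rpow hk.le ?_ (by linarith)
            rw [bracket_sub_comm]
            exact hM p k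
        _ = C ^ (-s) * Λ p ^ (-s) * (bracket (p - k) ^ M) ^ (-s) := by
            rw [Real.mul_rpow (by positivity) (by positivity), Real.mul_rpow hC.le hp.le]
        _ ≤ _ := by gcongr; exact hb (-s) _ (by linarith)
    have e1 : Λ k ^ s * Λ k ^ (-s) = 1 := by rw [← Real.rpow_add hk]; simp
    have e2 : Λ p ^ s * Λ p ^ (-s) = 1 := by rw [← Real.rpow_add hp]; simp
    have p1 := Real.rpow_pos_of_pos hk s
    have p2 := Real.rpow_pos_of_pos hp s
    calc Λ p ^ s = Λ p ^ s * Λ k ^ s * Λ k ^ (-s) := by rw [mul_assoc, e1, mul_one]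
      _ ≤ Λ p ^ s * Λ k ^ s * (C ^ (-s) * Λ p ^ (-s) * bracket (p - k) ^ ⌈M * (-s)⌉₊) := by gcongr
      _ = (Λ p ^ s * Λ p ^ (-s)) * (C ^ (-s) * Λ k ^ s * bracket (p - k) ^ ⌈M * (-s)⌉₊) := by ring
      _ = _ := by rw [e2, one_mul]

theorem IsModerate.rpow_le_rpow {n : ℕ} {Λ : Lattice n → ℝ} (h : IsModerate Λ) {s t : ℝ}
    (hst : s ≤ t) : ∃ C : ℝ, 0 < C ∧ ∀ k, Λ k ^ s ≤ C * Λ k ^ t := by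
  obtain ⟨c, hc, hk⟩ := h.lower
  refine ⟨c ^ (s - t), Real.rpow_pos_of_pos hc _, fun k => ?_⟩
  have hp := h.pos k
  calc Λ k ^ s = Λ k ^ (s - t) * Λ k ^ t := by rw [← Real.rpow_add hp]; simp
    _ ≤ _ := by
      have : s - t ≤ 0 := by linarith
      exact mul_le_mul_of_nonneg_right (Real.rpow_le_rpow_of_nonpos hc (hk k) this)
        (Real.rpow_nonneg hp.le _)

theorem exp_le_one_add_mul_exp (t : ℝ) : Real.exp t ≤ 1 + t * Real.exp t := by
  have h1 := Real.add_one_le_exp (-t)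
  have h2 : Real.exp (-t) * Real.exp t = 1 := by rw [← Real.exp_add]; simp
  nlinarith [Real.exp_pos t]

theorem exp_neg_two_mul_le {w : ℝ} (h0 : 0 ≤ w) (h1 : w ≤ 1 / 2) : Real.exp (-(2 * w)) ≤ 1 - w := by
  have h2 := Real.add_one_le_exp (2 * w)
  rw [Real.exp_neg, inv_le_iff_one_le_mul₀ (Real.exp_pos _)]
  nlinarith

/-- A mean value estimate: the derivative `u x^{u-1}` cancels the allowed increment `C x^{1-u}`. -/
theorem abs_rpow_sub_rpow_le {c C u : ℝ} (hc : 0 < c) (hC : 0 < C) (hu : 0 < u) :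
    ∃ D : ℝ, 0 < D ∧ ∀ x y, c ≤ x → c ≤ y → |y - x| ≤ C * x ^ (1 - u) → |y ^ u - x ^ u| ≤ D := by
  -- With `v = x^{-u}`, the first summand comes from `y ≤ x e^{Cv}`. The second covers `C v ≥ 1/2`,
  -- where `x^u ≤ 2C`; the third covers `C v ≤ 1/2`, where `y ≥ x e^{-2Cv}`.
  refine ⟨u * C * Real.exp (u * C * c ^ (-u)) + 2 * C + 2 * u * C, by positivity,
    fun x y hx hy hxy => ?_⟩
  have hx0 := hc.trans_le hx
  have hy0 := hc.trans_le hy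
  set v := x ^ (-u) with hv
  have hv0 : 0 < v := Real.rpow_pos_of_pos hx0 _
  have hxv : x ^ (1 - u) = x * v := by rw [hv, sub_eq_add_neg, Real.rpow_add hx0, Real.rpow_one]
  have hxuv : x ^ u * v = 1 := by rw [hv, ← Real.rpow_add hx0]; simp
  have hvV : v ≤ c ^ (-u) := Real.rpow_le_rpow_of_nonpos hc hx (by linarith)
  have hX : 0 < x ^ u := Real.rpow_pos_of_pos hx0 _
  have hY : 0 < y ^ u := Real.rpow_pos_of_pos hy0 _
  rw [hxv, abs_le] at hxy
  have e0 : 0 < u * C * Real.exp (u * C * c ^ (-u)) := by positivity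
  have huC : 0 < u * C := by positivity
  rw [abs_le]
  constructor
  · rcases le_total (1 / 2) (C * v) with h | h
    · have : x ^ u ≤ 2 * C := by nlinarith
      nlinarith
    · have h1 : x * Real.exp (-(2 * (C * v))) ≤ y := by
        have := exp_neg_two_mul_le (by positivity) h
        nlinarith
      have h2 := Real.rpow_le_rpow (by positivity) h1 hu.le
      rw [Real.mul_rpow hx0.le (Real.exp_pos _).le, ← Real.exp_mul] at h2
      have h3 := Real.add_one_le_exp (-(2 * (C * v)) * u)
      have h4 : x ^ u * (-(2 * (C * v)) * u + 1) ≤ y ^ u :=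
        (mul_le_mul_of_nonneg_left h3 hX.le).trans h2
      have h5 : x ^ u * (-(2 * (C * v)) * u + 1) = x ^ u - 2 * u * C * (x ^ u * v) := by ring
      rw [h5, hxuv] at h4
      linarith
  · have h1 : y ≤ x * Real.exp (C * v) := by
      have := Real.add_one_le_exp (C * v)
      nlinarith
    have h2 := Real.rpow_le_rpow hy0.le h1 hu.le
    rw [Real.mul_rpow hx0.le (Real.exp_pos _).le, ← Real.exp_mul] at h2
    have h3 := exp_le_one_add_mul_exp (C * v * u)
    have h4 : Real.exp (C * v * u) ≤ Real.exp (u * C * c ^ (-u)) := by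
      refine Real.exp_le_exp.2 ?_
      nlinarith
    have h5 : y ^ u ≤ x ^ u * (1 + C * v * u * Real.exp (u * C * c ^ (-u))) := by
      refine h2.trans (mul_le_mul_of_nonneg_left (h3.trans ?_) hX.le)
      gcongr
    have h6 : x ^ u * (1 + C * v * u * Real.exp (u * C * c ^ (-u))) =
        x ^ u + u * C * Real.exp (u * C * c ^ (-u)) * (x ^ u * v) := by ring
    rw [h6, hxuv] at h5
    linarith

/-- Lets the multi-index bounds be read off in a single coordinate direction, the only case the
argument needs besides the index zero. -/
theorem composeAll_eq_of_forall_ne {X : Type*} {n : ℕ} (A : Fin n → X → X) (j : Fin n)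
    (h : ∀ i, i ≠ j → A i = id) : composeAll A = A j := by
  have hid : ∀ {m : ℕ} (B : Fin m → X → X), (∀ i, B i = id) → composeAll B = id := by
    intro m
    induction m with
    | zero => intro B _; rfl
    | succ m ih =>
      intro B hB
      have := ih (fun i => B i.succ) fun i => hB _
      simp only [composeAll, List.ofFn_succ, List.foldr_cons] at this ⊢
      rw [this, hB 0]; rfl
  induction n with
  | zero => exact j.elim0
  | succ n ih =>
    have hs : composeAll A = A 0 ∘ composeAll fun i : Fin n => A i.succ := by
      simp [composeAll, List.ofFn_succ]
    rw [hs]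
    refine Fin.cases (fun h => ?_) (fun i h => ?_) j h
    · rw [hid _ fun i => h _ (Fin.succ_ne_zero i)]; rfl
    · rw [ih (fun i => A i.succ) i fun l hl => h _ fun e => hl (Fin.succ_injective _ e),
        h 0 (Fin.succ_ne_zero i).symm]; rfl

theorem composeAll_eq_id {X : Type*} {n : ℕ} (A : Fin n → X → X) (h : ∀ i, A i = id) :
    composeAll A = id := by
  rcases n with _ | n
  · rfl
  · rw [composeAll_eq_of_forall_ne A 0 fun i _ => h i, h]

theorem latticeDiff_zero {n : ℕ} {G : Type*} [AddCommGroup G] (f : Lattice n → G) :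
    latticeDiff 0 f = f := by
  rw [latticeDiff, composeAll_eq_id _ fun i => by simp]; rfl

theorem latticeDiff_single {n : ℕ} {G : Type*} [AddCommGroup G] (j : Fin n) (f : Lattice n → G)
    (k : Lattice n) : latticeDiff (Pi.single j 1) f k = f (k + Pi.single j 1) - f k := by
  rw [latticeDiff, composeAll_eq_of_forall_ne _ j fun i hi => by simp [hi]]
  simp [fwdDiff]

theorem multiLength_single {n : ℕ} (j : Fin n) (N : ℕ) : multiLength (Pi.single j N) = N := by
  simp [multiLength]

theorem multiLength_zero {n : ℕ} : multiLength (0 : Fin n → ℕ) = 0 := by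
  simp [multiLength]

/-- The first differences of `Λ` are `O(Λ^{1-1/μ})`, so `Λ^{1/μ}` is Lipschitz and grows at most
linearly away from any point. Raising to the power `μ` gives the polynomial bound. -/
theorem IsWeight.isModerate {n : ℕ} {μ : ℝ} {Λ : Lattice n → ℝ} (h : IsWeight μ Λ) :
    IsModerate Λ := by
  obtain ⟨μ₀, μ₁, C₀, C₁, h0, h01, h1, hC₀, -, hg⟩ := h.growth
  have hμ : 0 < μ := by linarith
  have hlow : ∀ k, C₀ ≤ Λ k := fun k => by
    refine le_trans ?_ (hg k).1
    have : (1 : ℝ) ≤ (1 + latticeNorm k) ^ μ₀ :=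
      Real.one_le_rpow (by linarith [show 0 ≤ latticeNorm k from Real.sqrt_nonneg _]) h0.le
    nlinarith
  refine ⟨⟨C₀, hC₀, hlow⟩, ?_⟩
  have hstep : ∀ j : Fin n, ∃ C : ℝ, 0 < C ∧ ∀ k,
      |Λ (k + Pi.single j 1) - Λ k| ≤ C * Λ k ^ (1 - 1 / μ) := fun j => by
    obtain ⟨C, hC, hk⟩ := h.diff_le (Pi.single j 1) 0 fun _ => by simp
    refine ⟨C, hC, fun k => ?_⟩
    have := hk k
    simpa [latticeMonomial, latticeDiff_single, multiLength_single] using this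
  choose C hC hk using hstep
  have hD : ∀ j, ∃ D : ℝ, 0 < D ∧ ∀ k, |Λ (k + Pi.single j 1) ^ (1 / μ) - Λ k ^ (1 / μ)| ≤ D :=
    fun j => by
      obtain ⟨D, hD, h⟩ := abs_rpow_sub_rpow_le hC₀ (hC j) (one_div_pos.2 hμ)
      exact ⟨D, hD, fun k => h _ _ (hlow _) (hlow _) (hk j k)⟩
  choose D hD0 hD using hD
  set W := ∑ j, D j with hW
  have hW0 : 0 ≤ W := Finset.sum_nonneg fun j _ => (hD0 j).le
  have hL : ∀ k p, Λ p ^ (1 / μ) ≤ Λ k ^ (1 / μ) + bracket (p - k) * W := fun k p => by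
    have := norm_sub_le_of_step (fun k => Λ k ^ (1 / μ)) k _ W (fun q j _ => (hD j q).trans
      (Finset.single_le_sum (f := D) (fun i _ => (hD0 i).le) (Finset.mem_univ j))) p le_rfl
    have h2 := (abs_le.1 this).2
    have : (latticeSize (p - k) : ℝ) * W ≤ bracket (p - k) * W := by
      gcongr; simp [bracket]
    linarith
  set c := C₀ ^ (1 / μ) with hc
  have hc0 : 0 < c := Real.rpow_pos_of_pos hC₀ _
  -- The lower bound `c ≤ Λ^{1/μ}` turns the additive Lipschitz estimate into a multiplicative one.
  have hL2 : ∀ k p, Λ p ^ (1 / μ) ≤ (1 + W / c) * (Λ k ^ (1 / μ) * bracket (p - k)) := fun k p => by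
    have h1 : c ≤ Λ k ^ (1 / μ) := Real.rpow_le_rpow hC₀.le (hlow k) (by positivity)
    have h2 := one_le_bracket (p - k)
    have h3 : bracket (p - k) * W ≤ W / c * (Λ k ^ (1 / μ) * bracket (p - k)) := by
      rw [div_mul_eq_mul_div, le_div_iff₀ hc0]
      have : 0 ≤ W * bracket (p - k) := by positivity
      nlinarith
    have h4 : Λ k ^ (1 / μ) ≤ Λ k ^ (1 / μ) * bracket (p - k) :=
      le_mul_of_one_le_right (hc0.le.trans h1) h2
    linarith [hL k p]
  refine ⟨(1 + W / c) ^ μ, ⌈μ⌉₊, by positivity, fun k p => ?_⟩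
  have hk0 : 0 < Λ k := hC₀.trans_le (hlow k)
  have hp0 : 0 < Λ p := hC₀.trans_le (hlow p)
  have hb := bracket_pos (p - k)
  have hinv : ∀ x : ℝ, 0 < x → (x ^ (1 / μ)) ^ μ = x := fun x hx => by
    rw [← Real.rpow_mul hx.le, one_div_mul_cancel hμ.ne', Real.rpow_one]
  have := Real.rpow_le_rpow (by positivity) (hL2 k p) hμ.le
  rw [hinv _ hp0, Real.mul_rpow (by positivity) (by positivity),
    Real.mul_rpow (by positivity) hb.le, hinv _ hk0, ← mul_assoc] at this
  refine this.trans ?_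
  gcongr
  rw [← Real.rpow_natCast]
  exact Real.rpow_le_rpow_of_exponent_le (one_le_bracket _) (Nat.le_ceil _)

/-! ## Kernels with off-diagonal decay -/

theorem summable_shift {n : ℕ} (g : L2 n) (η : Lattice n) :
    Summable fun k => ‖g (k - η)‖ ^ (2 : ENNReal).toReal :=
  ((lp.memℓp g).summable (by simp)).comp_injective (sub_left_injective (b := η))

theorem norm_mul_shift_le {n : ℕ} {c : Lattice n → ℂ} {D : ℝ} (hc : ∀ k, ‖c k‖ ≤ D) (g : L2 n)
    (η k : Lattice n) : ‖c k * g (k - η)‖ ^ (2 : ENNReal).toReal ≤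
      D ^ (2 : ENNReal).toReal * ‖g (k - η)‖ ^ (2 : ENNReal).toReal := by
  have hD : 0 ≤ D := (norm_nonneg _).trans (hc 0)
  rw [norm_mul, Real.mul_rpow (norm_nonneg _) (norm_nonneg _)]
  gcongr
  exact hc k

theorem memℓp_mul_shift {n : ℕ} {c : Lattice n → ℂ} {D : ℝ} (hc : ∀ k, ‖c k‖ ≤ D) (g : L2 n)
    (η : Lattice n) : Memℓp (fun k => c k * g (k - η)) 2 :=
  memℓp_gen (Summable.of_nonneg_of_le (fun k => by positivity) (norm_mul_shift_le hc g η)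
    ((summable_shift g η).mul_left _))

/-- The operator `g ↦ c(k) g(k - η)` for a bounded function `c`. -/
def weightedShift {n : ℕ} (η : Lattice n) (c : Lattice n → ℂ) (D : ℝ) (hc : ∀ k, ‖c k‖ ≤ D) :
    L2 n →L[ℂ] L2 n :=
  LinearMap.mkContinuous
    { toFun := fun g => ⟨fun k => c k * g (k - η), memℓp_mul_shift hc g η⟩
      map_add' := fun f g => lp.ext (funext fun k => mul_add (c k) (f (k - η)) (g (k - η)))
      map_smul' := fun a g => lp.ext (funext fun k => mul_left_comm (c k) a (g (k - η))) }
    D fun g => by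
      have hD : 0 ≤ D := (norm_nonneg _).trans (hc 0)
      refine lp.norm_le_of_tsum_le (by simp) (by positivity) ?_
      have hs := (memℓp_mul_shift hc g η).summable (by simp)
      refine (hs.tsum_le_tsum (norm_mul_shift_le hc g η)
        ((summable_shift g η).mul_left _)).trans ?_
      rw [tsum_mul_left, Real.mul_rpow hD (norm_nonneg _),
        lp.norm_rpow_eq_tsum (by simp) g]
      exact (congrArg _ ((Equiv.subRight η).tsum_eq
        fun k => ‖g k‖ ^ (2 : ENNReal).toReal)).le

theorem weightedShift_apply {n : ℕ} (η : Lattice n) (c : Lattice n → ℂ) (D : ℝ)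
    (hc : ∀ k, ‖c k‖ ≤ D) (g : L2 n) (k : Lattice n) :
    weightedShift η c D hc g k = c k * g (k - η) := rfl

theorem norm_weightedShift_le {n : ℕ} (η : Lattice n) (c : Lattice n → ℂ) (D : ℝ)
    (hc : ∀ k, ‖c k‖ ≤ D) : ‖weightedShift η c D hc‖ ≤ D :=
  LinearMap.mkContinuous_norm_le _ ((norm_nonneg _).trans (hc 0)) _

/-- Split the matrix into its diagonals `k - l = η`. Each is a weighted shift of norm at most `C
⟨η⟩^{-2n}`, so their sum converges absolutely in operator norm. -/
theorem exists_clm_of_kernel_le {n : ℕ} {K : Lattice n → Lattice n → ℂ} {C : ℝ}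
    (hK : ∀ k l, ‖K k l‖ ≤ C * (bracket (k - l) ^ (2 * n))⁻¹) :
    ∃ T : L2 n →L[ℂ] L2 n, ∀ (g : L2 n) k, HasSum (fun l => K k l * g l) (T g k) := by
  have hc : ∀ η k, ‖K k (k - η)‖ ≤ C * (bracket η ^ (2 * n))⁻¹ := fun η k => by
    simpa using hK k (k - η)
  have hs : Summable fun η : Lattice n => weightedShift η _ _ (hc η) :=
    Summable.of_norm_bounded ((summable_bracket n).mul_left C) fun η => norm_weightedShift_le _ _ _ _
  refine ⟨∑' η, weightedShift η _ _ (hc η), fun g k => ?_⟩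
  have h1 := hs.hasSum.mapL (ContinuousLinearMap.apply ℂ (L2 n) g)
  have h2 := h1.mapL (lp.evalCLM ℂ (fun _ : Lattice n => ℂ) 2 k)
  have h3 : HasSum (fun η => K k (k - η) * g (k - η))
      ((∑' η, weightedShift η _ _ (hc η)) g k) := h2
  exact (Equiv.subLeft k).hasSum_iff.1 h3

/-- The kernel `K` has order `s` with respect to the weight `Λ`. -/
def HasOrder {n : ℕ} (Λ : Lattice n → ℝ) (s : ℝ) (K : Lattice n → Lattice n → ℂ) : Prop :=
  ∀ N : ℕ, ∃ C : ℝ, 0 ≤ C ∧ ∀ k l, ‖K k l‖ ≤ C * Λ k ^ s * (bracket (k - l) ^ N)⁻¹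

/-- Replacing `Λ(l)^b` by `Λ(k)^b` costs a factor `⟨k-l⟩^M`, paid for by starting from decay of
order `N + M`. -/
theorem HasOrder.weighted {n : ℕ} {Λ : Lattice n → ℝ} (hΛ : IsModerate Λ) {s : ℝ}
    {K : Lattice n → Lattice n → ℂ} (hK : HasOrder Λ s K) (a b : ℝ) :
    HasOrder Λ (a + s + b) fun k l => ((Λ k ^ a : ℝ) : ℂ) * K k l * ((Λ l ^ b : ℝ) : ℂ) := by
  intro N
  obtain ⟨D, M, hD, hM⟩ := hΛ.rpow_le b
  obtain ⟨C, hC, hK⟩ := hK (N + M)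
  refine ⟨C * D, by positivity, fun k l => ?_⟩
  have hk := hΛ.pos k
  have hl := hΛ.pos l
  have hb := bracket_pos (k - l)
  have h1 := hM k l
  rw [bracket_sub_comm] at h1
  rw [norm_mul, norm_mul, Complex.norm_real, Complex.norm_real,
    Real.norm_of_nonneg (Real.rpow_nonneg hk.le _), Real.norm_of_nonneg (Real.rpow_nonneg hl.le _)]
  calc Λ k ^ a * ‖K k l‖ * Λ l ^ b
      ≤ Λ k ^ a * (C * Λ k ^ s * (bracket (k - l) ^ (N + M))⁻¹) *
        (D * Λ k ^ b * bracket (k - l) ^ M) := by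
        gcongr
        exact hK k l
    _ = C * D * (Λ k ^ a * Λ k ^ s * Λ k ^ b) * (bracket (k - l) ^ N)⁻¹ := by
        rw [pow_add]; field_simp
    _ = _ := by rw [Real.rpow_add hk, Real.rpow_add hk]

theorem HasOrder.exists_clm {n : ℕ} {Λ : Lattice n → ℝ} (hΛ : IsModerate Λ) {s : ℝ}
    {K : Lattice n → Lattice n → ℂ} (hK : HasOrder Λ s K) (a b : ℝ) (hab : a + s + b = 0) :
    ∃ T : L2 n →L[ℂ] L2 n, ∀ (g : L2 n) k,
      HasSum (fun l => ((Λ k ^ a : ℝ) : ℂ) * K k l * ((Λ l ^ b : ℝ) : ℂ) * g l) (T g k) := by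
  obtain ⟨C, hC, h⟩ := hK.weighted hΛ a b (2 * n)
  refine exists_clm_of_kernel_le (C := C) fun k l => ?_
  simpa [hab] using h k l

/-- `Λ^s g ∈ ℓ²`. -/
def IsSobolev {n : ℕ} (Λ : Lattice n → ℝ) (s : ℝ) (g : Lattice n → ℂ) : Prop :=
  ∃ u : L2 n, ∀ k, u k = ((Λ k ^ s : ℝ) : ℂ) * g k

theorem IsSobolev.sub {n : ℕ} {Λ : Lattice n → ℝ} {s : ℝ} {f g : Lattice n → ℂ}
    (hf : IsSobolev Λ s f) (hg : IsSobolev Λ s g) : IsSobolev Λ s (f - g) := by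
  obtain ⟨u, hu⟩ := hf
  obtain ⟨v, hv⟩ := hg
  refine ⟨u - v, fun k => ?_⟩
  rw [Pi.sub_apply, mul_sub, ← hu, ← hv]; rfl

theorem isSobolev_zero {n : ℕ} (Λ : Lattice n → ℝ) (g : L2 n) : IsSobolev Λ 0 g :=
  ⟨g, fun k => by simp⟩

theorem IsSobolev.mono {n : ℕ} {Λ : Lattice n → ℝ} (hΛ : IsModerate Λ) {s t : ℝ} (hst : s ≤ t)
    {g : Lattice n → ℂ} (hg : IsSobolev Λ t g) : IsSobolev Λ s g := by
  obtain ⟨u, hu⟩ := hg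
  obtain ⟨C, hC, h⟩ := hΛ.rpow_le_rpow (sub_nonpos.2 hst)
  have hc : ∀ k, ‖((Λ k ^ (s - t) : ℝ) : ℂ)‖ ≤ C := fun k => by
    rw [Complex.norm_real, Real.norm_of_nonneg (Real.rpow_nonneg (hΛ.pos k).le _)]
    simpa using h k
  refine ⟨weightedShift 0 _ C hc u, fun k => ?_⟩
  rw [weightedShift_apply, sub_zero, hu, ← mul_assoc, ← Complex.ofReal_mul,
    ← Real.rpow_add (hΛ.pos k)]
  simp

theorem rpow_neg_mul_rpow_cast {x : ℝ} (hx : 0 < x) (t : ℝ) :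
    ((x ^ (-t) : ℝ) : ℂ) * ((x ^ t : ℝ) : ℂ) = 1 := by
  rw [← Complex.ofReal_mul, ← Real.rpow_add hx]; simp

/-- A kernel of order `s` maps `Λ^{-t} ℓ²` into `Λ^{s-t} ℓ²`. -/
theorem HasOrder.isSobolev {n : ℕ} {Λ : Lattice n → ℝ} (hΛ : IsModerate Λ) {s t : ℝ}
    {K : Lattice n → Lattice n → ℂ} (hK : HasOrder Λ s K) {g h : Lattice n → ℂ}
    (hg : IsSobolev Λ t g) (hh : ∀ k, HasSum (fun l => K k l * g l) (h k)) :
    IsSobolev Λ (t - s) h := by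
  obtain ⟨u, hu⟩ := hg
  obtain ⟨T, hT⟩ := hK.exists_clm hΛ (t - s) (-t) (by ring)
  refine ⟨T u, fun k => (hT u k).unique (((hh k).mul_left _).congr_fun fun l => ?_)⟩
  rw [hu, mul_assoc, mul_assoc, ← mul_assoc _ _ (g l), rpow_neg_mul_rpow_cast (hΛ.pos l), one_mul]

/-- `Λ^s` grows at most polynomially, by moderateness at the origin. Of the decay `M + 2n`, `M`
powers absorb the weight and `2n` make the product summable, hence square summable. -/
theorem IsRapidlyDecreasing.isSobolev {n : ℕ} {Λ : Lattice n → ℝ} (hΛ : IsModerate Λ) (s : ℝ)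
    {φ : Lattice n → ℂ} (hφ : IsRapidlyDecreasing φ) : IsSobolev Λ s φ := by
  obtain ⟨D, M, hD, hM⟩ := hΛ.rpow_le s
  obtain ⟨C, hC⟩ := hφ (M + 2 * n)
  have h1 : Memℓp (fun k => ((Λ k ^ s : ℝ) : ℂ) * φ k) 1 := by
    refine memℓp_gen ?_
    simp only [ENNReal.toReal_one, Real.rpow_one]
    refine Summable.of_nonneg_of_le (fun k => norm_nonneg _) (fun k => ?_)
      ((summable_bracket n).mul_left (D * Λ 0 ^ s * |C| * (1 + n) ^ (M + 2 * n)))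
    have h0 := hΛ.pos 0
    have hk := hM 0 k
    rw [sub_zero] at hk
    have hb := bracket_pos k
    rw [norm_mul, Complex.norm_real, Real.norm_of_nonneg (Real.rpow_nonneg (hΛ.pos k).le _)]
    have h2 : ((1 + latticeNorm k) ^ (M + 2 * n))⁻¹ ≤
        (1 + n) ^ (M + 2 * n) * (bracket k ^ (M + 2 * n))⁻¹ := by
      have hn : 0 ≤ latticeNorm k := Real.sqrt_nonneg _
      rw [inv_le_iff_one_le_mul₀ (by positivity), mul_right_comm, ← mul_pow, ← div_eq_mul_inv,
        one_le_div (by positivity)]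
      exact pow_le_pow_left₀ hb.le (bracket_le_latticeNorm k) _
    calc Λ k ^ s * ‖φ k‖ ≤ (D * Λ 0 ^ s * bracket k ^ M) *
          (|C| * ((1 + n) ^ (M + 2 * n) * (bracket k ^ (M + 2 * n))⁻¹)) := by
          gcongr
          refine (hC k).trans ?_
          exact mul_le_mul (le_abs_self C) h2 (inv_nonneg.2 (pow_nonneg
            (add_nonneg zero_le_one (Real.sqrt_nonneg _)) _)) (abs_nonneg C)
      _ = _ := by rw [pow_add (bracket k)]; field_simp
  exact ⟨⟨_, h1.of_exponent_ge (by norm_num)⟩, fun k => rfl⟩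

/-! ## Calculus on the torus -/

/-- The projection `ℝⁿ → 𝕋ⁿ`. -/
def torusMk {n : ℕ} (y : Fin n → ℝ) : Torus n := fun j => (y j : UnitAddCircle)

theorem torusMk_surjective {n : ℕ} : Function.Surjective (torusMk (n := n)) := fun x =>
  ⟨fun j => (QuotientAddGroup.mk_surjective (x j)).choose,
    funext fun j => (QuotientAddGroup.mk_surjective (x j)).choose_spec⟩

theorem torusMk_add_single {n : ℕ} (y : Fin n → ℝ) (j : Fin n) (t : ℝ) :
    torusMk y + Pi.single j (t : UnitAddCircle) = torusMk (y + t • Pi.single j 1) := by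
  funext i
  by_cases h : i = j
  · subst h; simp [torusMk]
  · simp [torusMk, h]

theorem two_pi_I_ne_zero : (2 * Real.pi * Complex.I : ℂ) ≠ 0 := Complex.two_pi_I_ne_zero

theorem TorusSmooth.contDiff {n : ℕ} {F : Torus n → ℂ} (hF : TorusSmooth F) :
    ContDiff ℝ ∞ fun y => F (torusMk y) := hF

theorem TorusSmooth.torusD_torusMk {n : ℕ} {F : Torus n → ℂ} (hF : TorusSmooth F) (j : Fin n)
    (y : Fin n → ℝ) : torusD j F (torusMk y) =
      (2 * Real.pi * Complex.I)⁻¹ * fderiv ℝ (fun y => F (torusMk y)) y (Pi.single j 1) := by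
  rw [torusD]
  congr 1
  simp only [torusMk_add_single]
  have h1 : HasFDerivAt (fun y => F (torusMk y)) (fderiv ℝ (fun y => F (torusMk y)) y)
      (y + (0 : ℝ) • Pi.single j 1) := by
    rw [zero_smul, add_zero]
    exact ((hF.contDiff.differentiable (by simp)) y).hasFDerivAt
  have h2 : HasDerivAt (fun t : ℝ => y + t • (Pi.single j 1 : Fin n → ℝ)) (Pi.single j 1) 0 := by
    simpa using ((hasDerivAt_id (0 : ℝ)).smul_const (Pi.single j (1 : ℝ) : Fin n → ℝ)).const_add y
  exact (h1.comp_hasDerivAt (0 : ℝ) h2).deriv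

theorem TorusSmooth.torusD {n : ℕ} {F : Torus n → ℂ} (hF : TorusSmooth F) (j : Fin n) :
    TorusSmooth (torusD j F) := by
  have h : ContDiff ℝ ∞ fun y => LatticePDO.torusD j F (torusMk y) := by
    simp only [hF.torusD_torusMk]
    exact contDiff_const.mul ((hF.contDiff.fderiv_right (m := ∞) (by simp)).clm_apply
      contDiff_const)
  exact h

theorem TorusSmooth.hasDerivAt {n : ℕ} {F : Torus n → ℂ} (hF : TorusSmooth F) (j : Fin n)
    (x : Torus n) (t : ℝ) :
    HasDerivAt (fun s : ℝ => F (x + Pi.single j (s : UnitAddCircle)))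
      (2 * Real.pi * Complex.I * LatticePDO.torusD j F (x + Pi.single j (t : UnitAddCircle))) t := by
  obtain ⟨y, rfl⟩ := torusMk_surjective x
  simp only [torusMk_add_single, hF.torusD_torusMk]
  rw [mul_inv_cancel_left₀ two_pi_I_ne_zero]
  have h2 : HasDerivAt (fun t : ℝ => y + t • (Pi.single j 1 : Fin n → ℝ)) (Pi.single j 1) t := by
    simpa using ((hasDerivAt_id t).smul_const (Pi.single j (1 : ℝ) : Fin n → ℝ)).const_add y
  exact (((hF.contDiff.differentiable (by simp)) _).hasFDerivAt).comp_hasDerivAt t h2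

theorem TorusSmooth.hasDerivAt_zero {n : ℕ} {F : Torus n → ℂ} (hF : TorusSmooth F) (j : Fin n)
    (x : Torus n) :
    HasDerivAt (fun s : ℝ => F (x + Pi.single j (s : UnitAddCircle)))
      (2 * Real.pi * Complex.I * LatticePDO.torusD j F x) 0 := by
  simpa using hF.hasDerivAt j x 0

theorem torusD_eq_of_hasDerivAt {n : ℕ} {F : Torus n → ℂ} {j : Fin n} {x : Torus n} {a : ℂ}
    (h : HasDerivAt (fun s : ℝ => F (x + Pi.single j (s : UnitAddCircle)))
      (2 * Real.pi * Complex.I * a) 0) : torusD j F x = a := by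
  rw [torusD, h.deriv, inv_mul_cancel_left₀ two_pi_I_ne_zero]

theorem TorusSmooth.add {n : ℕ} {F G : Torus n → ℂ} (hF : TorusSmooth F) (hG : TorusSmooth G) :
    TorusSmooth fun x => F x + G x := ContDiff.add hF hG

theorem TorusSmooth.mul {n : ℕ} {F G : Torus n → ℂ} (hF : TorusSmooth F) (hG : TorusSmooth G) :
    TorusSmooth fun x => F x * G x := ContDiff.mul hF hG

theorem torusSmooth_const {n : ℕ} (c : ℂ) : TorusSmooth fun _ : Torus n => c := contDiff_const

theorem TorusSmooth.const_mul {n : ℕ} {F : Torus n → ℂ} (c : ℂ) (hF : TorusSmooth F) :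
    TorusSmooth fun x => c * F x := (torusSmooth_const c).mul hF

theorem TorusSmooth.sub {n : ℕ} {F G : Torus n → ℂ} (hF : TorusSmooth F) (hG : TorusSmooth G) :
    TorusSmooth fun x => F x - G x := ContDiff.sub hF hG

theorem TorusSmooth.inv {n : ℕ} {F : Torus n → ℂ} (hF : TorusSmooth F) (h0 : ∀ x, F x ≠ 0) :
    TorusSmooth fun x => (F x)⁻¹ := ContDiff.inv hF fun _ => h0 _

theorem torusD_add {n : ℕ} {F G : Torus n → ℂ} (hF : TorusSmooth F) (hG : TorusSmooth G)
    (j : Fin n) : torusD j (fun x => F x + G x) = fun x => torusD j F x + torusD j G x :=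
  funext fun x => torusD_eq_of_hasDerivAt (by
    rw [mul_add]; exact (hF.hasDerivAt_zero j x).add (hG.hasDerivAt_zero j x))

theorem torusD_mul {n : ℕ} {F G : Torus n → ℂ} (hF : TorusSmooth F) (hG : TorusSmooth G)
    (j : Fin n) : torusD j (fun x => F x * G x) =
      fun x => torusD j F x * G x + F x * torusD j G x :=
  funext fun x => torusD_eq_of_hasDerivAt (by
    convert! (hF.hasDerivAt_zero j x).mul (hG.hasDerivAt_zero j x) using 1
    simp; ring)

theorem torusD_const_mul {n : ℕ} {F : Torus n → ℂ} (c : ℂ) (hF : TorusSmooth F)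
    (j : Fin n) : torusD j (fun x => c * F x) = fun x => c * torusD j F x :=
  funext fun x => torusD_eq_of_hasDerivAt (by
    convert! (hF.hasDerivAt_zero j x).const_mul c using 1
    ring)

theorem torusD_inv {n : ℕ} {F : Torus n → ℂ} (hF : TorusSmooth F) (h0 : ∀ x, F x ≠ 0)
    (j : Fin n) : torusD j (fun x => (F x)⁻¹) =
      fun x => -1 * (torusD j F x * ((F x)⁻¹ * (F x)⁻¹)) :=
  funext fun x => torusD_eq_of_hasDerivAt (by
    have := (hF.hasDerivAt_zero j x).inv (h0 _)
    convert! this using 1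
    have := h0 x
    simp; field_simp)

theorem mFourier_add_apply {n : ℕ} (k : Lattice n) (x y : Torus n) :
    UnitAddTorus.mFourier k (x + y) = UnitAddTorus.mFourier k x * UnitAddTorus.mFourier k y := by
  simp [UnitAddTorus.mFourier, fourier_apply, smul_add, AddCircle.toCircle_add,
    Finset.prod_mul_distrib]

theorem mFourier_single_apply {n : ℕ} (k : Lattice n) (j : Fin n) (t : ℝ) :
    UnitAddTorus.mFourier k (Pi.single j (t : UnitAddCircle)) =
      Complex.exp (2 * Real.pi * Complex.I * k j * t) := by
  simp only [UnitAddTorus.mFourier, ContinuousMap.coe_mk]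
  rw [Finset.prod_eq_single j]
  · rw [Pi.single_eq_same, fourier_coe_apply]; simp
  · intro i _ hi
    rw [Pi.single_eq_of_ne hi, fourier_eval_zero]
  · simp

theorem torusSmooth_mFourier {n : ℕ} (k : Lattice n) :
    TorusSmooth (UnitAddTorus.mFourier k) := by
  simp only [TorusSmooth, UnitAddTorus.mFourier, ContinuousMap.coe_mk, fourier_coe_apply]
  refine contDiff_prod fun i _ => ContDiff.cexp ?_
  refine ContDiff.div_const (contDiff_const.mul ?_) _
  exact Complex.ofRealCLM.contDiff.comp (contDiff_apply ℝ ℝ i)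

theorem torusD_mFourier {n : ℕ} (k : Lattice n) (j : Fin n) (x : Torus n) :
    torusD j (UnitAddTorus.mFourier k) x = k j * UnitAddTorus.mFourier k x :=
  torusD_eq_of_hasDerivAt (by
    simp only [mFourier_add_apply, mFourier_single_apply]
    have h1 : HasDerivAt (fun s : ℝ => 2 * Real.pi * Complex.I * k j * (s : ℂ))
        (2 * Real.pi * Complex.I * k j) 0 := by
      simpa using (Complex.ofRealCLM.hasDerivAt (x := 0)).const_mul
        (2 * Real.pi * Complex.I * k j : ℂ)
    convert! h1.cexp.const_mul (UnitAddTorus.mFourier k x) using 1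
    simp; ring)

theorem TorusSmooth.integrable {n : ℕ} {F : Torus n → ℂ} (hF : TorusSmooth F) :
    Integrable F (torusMeasure n) :=
  hF.continuous.integrable_of_hasCompactSupport (HasCompactSupport.of_compactSpace _)

theorem TorusSmooth.exists_bound {n : ℕ} {F : Torus n → ℂ} (hF : TorusSmooth F) :
    ∃ C : ℝ, ∀ x, ‖F x‖ ≤ C := by
  obtain ⟨C, hC⟩ := isCompact_univ.exists_bound_of_continuousOn hF.continuous.continuousOn
  exact ⟨C, fun x => hC x (Set.mem_univ x)⟩

instance torusMeasure_isAddLeftInvariant (n : ℕ) : (torusMeasure n).IsAddLeftInvariant := by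
  unfold torusMeasure; infer_instance

/-- By translation invariance `∫ F(x + a(t)) dx` does not depend on `t`; differentiate it under the
integral sign. -/
theorem integral_eq_zero_of_hasDerivAt_translate {n : ℕ} {F G : Torus n → ℂ} (hF : Continuous F)
    (hG : Continuous G) (a : ℝ → Torus n)
    (h : ∀ x t, HasDerivAt (fun s => F (x + a s)) (G (x + a t)) t) :
    ∫ x, G x ∂(torusMeasure n) = 0 := by
  obtain ⟨C, hC⟩ := isCompact_univ.exists_bound_of_continuousOn hG.continuousOn
  have hcF : ∀ t, Continuous fun x => F (x + a t) := fun t => hF.comp (continuous_add_const _)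
  have hcG : ∀ t, Continuous fun x => G (x + a t) := fun t => hG.comp (continuous_add_const _)
  have h1 := (hasDerivAt_integral_of_dominated_loc_of_deriv_le (μ := torusMeasure n)
    (F := fun t x => F (x + a t)) (F' := fun t x => G (x + a t)) (x₀ := 0) (s := Set.univ)
    (bound := fun _ => C) univ_mem (Eventually.of_forall fun t => (hcF t).aestronglyMeasurable)
    ((hcF 0).integrable_of_hasCompactSupport (HasCompactSupport.of_compactSpace _))
    (hcG 0).aestronglyMeasurable (Eventually.of_forall fun x t _ => hC _ (Set.mem_univ _))
    (integrable_const _) (Eventually.of_forall fun x t _ => h x t)).2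
  have hinv : (fun t => ∫ x, F (x + a t) ∂(torusMeasure n)) = fun _ => ∫ x, F x ∂(torusMeasure n) :=
    funext fun t => integral_add_right_eq_self (μ := torusMeasure n) F _
  rw [hinv, integral_add_right_eq_self (μ := torusMeasure n) G] at h1
  exact h1.unique (hasDerivAt_const (0 : ℝ) _)

theorem integral_torusD {n : ℕ} {F : Torus n → ℂ} (hF : TorusSmooth F) (j : Fin n) :
    ∫ x, torusD j F x ∂(torusMeasure n) = 0 := by
  have h := integral_eq_zero_of_hasDerivAt_translate
    (G := fun x => 2 * Real.pi * Complex.I * torusD j F x) hF.continuous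
    (continuous_const.mul (hF.torusD j).continuous) _ (hF.hasDerivAt j)
  rw [integral_const_mul] at h
  exact (mul_eq_zero.1 h).resolve_left two_pi_I_ne_zero

/-- The integral `∫ e^{2πi η·x} F(x) dx`. -/
def torusCoeff {n : ℕ} (F : Torus n → ℂ) (η : Lattice n) : ℂ :=
  ∫ x, UnitAddTorus.mFourier η x * F x ∂(torusMeasure n)

theorem norm_torusCoeff_le {n : ℕ} {F : Torus n → ℂ} {C : ℝ} (h : ∀ x, ‖F x‖ ≤ C)
    (η : Lattice n) : ‖torusCoeff F η‖ ≤ C := by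
  have := norm_integral_le_of_norm_le_const (μ := torusMeasure n)
    (f := fun x => UnitAddTorus.mFourier η x * F x) (C := C) (Eventually.of_forall fun x => by
      rw [norm_mul]
      exact (mul_le_of_le_one_left (norm_nonneg _) (norm_mFourier_apply η x)).trans (h x))
  simpa [torusCoeff] using this

/-- Integration by parts: the derivative of the exponential times `F` has integral zero. -/
theorem torusCoeff_torusD {n : ℕ} {F : Torus n → ℂ} (hF : TorusSmooth F) (j : Fin n)
    (η : Lattice n) : torusCoeff (torusD j F) η = -(η j * torusCoeff F η) := by
  have he := torusSmooth_mFourier η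
  have h := integral_torusD (he.mul hF) j
  rw [torusD_mul he hF, integral_add (((he.torusD j).mul hF).integrable)
    ((he.mul (hF.torusD j)).integrable)] at h
  simp only [torusD_mFourier, mul_assoc] at h
  rw [integral_const_mul] at h
  exact eq_neg_of_add_eq_zero_right h

theorem torusCoeff_const_mul {n : ℕ} (c : ℂ) (F : Torus n → ℂ) (η : Lattice n) :
    torusCoeff (fun x => c * F x) η = c * torusCoeff F η := by
  simp only [torusCoeff, mul_left_comm _ c, integral_const_mul]

theorem torusCoeff_sub {n : ℕ} {F G : Torus n → ℂ} (hF : TorusSmooth F) (hG : TorusSmooth G)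
    (η : Lattice n) : torusCoeff (fun x => F x - G x) η = torusCoeff F η - torusCoeff G η := by
  simp only [torusCoeff, mul_sub]
  exact integral_sub ((torusSmooth_mFourier η).mul hF).integrable
    ((torusSmooth_mFourier η).mul hG).integrable

/-! ## Families of functions with uniformly bounded derivatives -/

/-- The derivatives `D_{x_j}^i F`, `i ≤ N`, are bounded uniformly over the family `F`. -/
def BddDeriv {n : ℕ} {ι : Type*} (j : Fin n) : ℕ → (ι → Torus n → ℂ) → Prop
  | 0, F => ∃ C : ℝ, ∀ i x, ‖F i x‖ ≤ C
  | N + 1, F => (∃ C : ℝ, ∀ i x, ‖F i x‖ ≤ C) ∧ BddDeriv j N fun i => torusD j (F i)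

section BddDeriv

variable {n : ℕ} {ι : Type*} {j : Fin n}

theorem BddDeriv.bounded {N : ℕ} {F : ι → Torus n → ℂ} (h : BddDeriv j N F) :
    ∃ C : ℝ, ∀ i x, ‖F i x‖ ≤ C := by
  cases N with
  | zero => exact h
  | succ N => exact h.1

theorem BddDeriv.of_succ {N : ℕ} {F : ι → Torus n → ℂ} (h : BddDeriv j (N + 1) F) :
    BddDeriv j N F := by
  induction N generalizing F with
  | zero => exact h.1
  | succ N ih => exact ⟨h.1, ih h.2⟩

theorem bounded_add {F G : ι → Torus n → ℂ} (hF : ∃ C : ℝ, ∀ i x, ‖F i x‖ ≤ C)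
    (hG : ∃ C : ℝ, ∀ i x, ‖G i x‖ ≤ C) : ∃ C : ℝ, ∀ i x, ‖F i x + G i x‖ ≤ C := by
  obtain ⟨C, hC⟩ := hF
  obtain ⟨D, hD⟩ := hG
  exact ⟨C + D, fun i x => (norm_add_le _ _).trans (add_le_add (hC i x) (hD i x))⟩

theorem bounded_mul {F G : ι → Torus n → ℂ} (hF : ∃ C : ℝ, ∀ i x, ‖F i x‖ ≤ C)
    (hG : ∃ C : ℝ, ∀ i x, ‖G i x‖ ≤ C) : ∃ C : ℝ, ∀ i x, ‖F i x * G i x‖ ≤ C := by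
  obtain ⟨C, hC⟩ := hF
  obtain ⟨D, hD⟩ := hG
  refine ⟨C * D, fun i x => ?_⟩
  rw [norm_mul]
  exact mul_le_mul (hC i x) (hD i x) (norm_nonneg _) ((norm_nonneg _).trans (hC i x))

theorem BddDeriv.add {N : ℕ} {F G : ι → Torus n → ℂ} (sF : ∀ i, TorusSmooth (F i))
    (sG : ∀ i, TorusSmooth (G i)) (hF : BddDeriv j N F) (hG : BddDeriv j N G) :
    BddDeriv j N fun i x => F i x + G i x := by
  induction N generalizing F G with
  | zero => exact bounded_add hF hG
  | succ N ih =>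
    refine ⟨bounded_add hF.1 hG.1, ?_⟩
    simp only [torusD_add (sF _) (sG _)]
    exact ih (fun i => (sF i).torusD j) (fun i => (sG i).torusD j) hF.2 hG.2

theorem BddDeriv.const_mul {N : ℕ} {F : ι → Torus n → ℂ} (sF : ∀ i, TorusSmooth (F i))
    (hF : BddDeriv j N F) (c : ℂ) : BddDeriv j N fun i x => c * F i x := by
  induction N generalizing F with
  | zero => exact bounded_mul ⟨‖c‖, fun _ _ => le_rfl⟩ hF
  | succ N ih =>
    refine ⟨bounded_mul ⟨‖c‖, fun _ _ => le_rfl⟩ hF.1, ?_⟩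
    simp only [torusD_const_mul c (sF _)]
    exact ih (fun i => (sF i).torusD j) hF.2

theorem BddDeriv.mul {N : ℕ} {F G : ι → Torus n → ℂ} (sF : ∀ i, TorusSmooth (F i))
    (sG : ∀ i, TorusSmooth (G i)) (hF : BddDeriv j N F) (hG : BddDeriv j N G) :
    BddDeriv j N fun i x => F i x * G i x := by
  induction N generalizing F G with
  | zero => exact bounded_mul hF hG
  | succ N ih =>
    refine ⟨bounded_mul hF.1 hG.1, ?_⟩
    simp only [torusD_mul (sF _) (sG _)]
    exact BddDeriv.add (fun i => ((sF i).torusD j).mul (sG i))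
      (fun i => (sF i).mul ((sG i).torusD j))
      (ih (fun i => (sF i).torusD j) sG hF.2 hG.of_succ)
      (ih sF (fun i => (sG i).torusD j) hF.of_succ hG.2)

/-- Since `D(1/F) = -DF/F²`, bounds on `N` derivatives of `1/F` and the product rule give a bound on
one more. -/
theorem BddDeriv.inv {N : ℕ} {F : ι → Torus n → ℂ} (sF : ∀ i, TorusSmooth (F i))
    (hF : BddDeriv j N F) {c : ℝ} (hc : 0 < c) (h : ∀ i x, c ≤ ‖F i x‖) :
    BddDeriv j N fun i x => (F i x)⁻¹ := by
  have h0 : ∀ i x, F i x ≠ 0 := fun i x => norm_pos_iff.1 (hc.trans_le (h i x))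
  have hb : ∃ C : ℝ, ∀ i x, ‖(F i x)⁻¹‖ ≤ C := ⟨c⁻¹, fun i x => by
    rw [norm_inv]; exact inv_anti₀ hc (h i x)⟩
  have sI := fun i => (sF i).inv (h0 i)
  induction N with
  | zero => exact hb
  | succ N ih =>
    refine ⟨hb, ?_⟩
    simp only [torusD_inv (sF _) (h0 _)]
    have hI := ih hF.of_succ
    exact BddDeriv.const_mul (fun i => ((sF i).torusD j).mul ((sI i).mul (sI i)))
      (BddDeriv.mul (fun i => (sF i).torusD j) (fun i => (sI i).mul (sI i)) hF.2
        (BddDeriv.mul sI sI hI hI)) _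

theorem torusD_torusDFalling (j : Fin n) (ℓ : ℕ) (F : Torus n → ℂ) :
    torusD j (torusDFalling j ℓ F) =
      fun x => torusDFalling j (ℓ + 1) F x + (ℓ : ℂ) * torusDFalling j ℓ F x := by
  funext x
  simp [torusDFalling]

theorem TorusSmooth.torusDFalling {F : Torus n → ℂ} (hF : TorusSmooth F) (j : Fin n) (ℓ : ℕ) :
    TorusSmooth (torusDFalling j ℓ F) := by
  induction ℓ with
  | zero => exact hF
  | succ ℓ ih => exact (ih.torusD j).sub (ih.const_mul _)

/-- Trades the falling factorials of the symbol estimates for plain powers of `D`, which obey the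
Leibniz rule: `D D^{(ℓ)} = D^{(ℓ+1)} + ℓ D^{(ℓ)}`. The induction on `N` must keep `ℓ` free. -/
theorem bddDeriv_of_torusDFalling {F : ι → Torus n → ℂ} (sF : ∀ i, TorusSmooth (F i))
    (h : ∀ ℓ, ∃ C : ℝ, ∀ i x, ‖torusDFalling j ℓ (F i) x‖ ≤ C) (N ℓ : ℕ) :
    BddDeriv j N fun i => torusDFalling j ℓ (F i) := by
  induction N generalizing ℓ with
  | zero => exact h ℓ
  | succ N ih =>
    refine ⟨h ℓ, ?_⟩
    simp only [torusD_torusDFalling]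
    exact (ih (ℓ + 1)).add (fun i => (sF i).torusDFalling j _)
      (fun i => ((sF i).torusDFalling j _).const_mul _)
      ((ih ℓ).const_mul (fun i => (sF i).torusDFalling j _) _)

theorem BddDeriv.torusCoeff_le {N : ℕ} {F : ι → Torus n → ℂ} (sF : ∀ i, TorusSmooth (F i))
    (hF : BddDeriv j N F) : ∃ C : ℝ, ∀ i η, |(η j : ℝ)| ^ N * ‖torusCoeff (F i) η‖ ≤ C := by
  induction N generalizing F with
  | zero =>
    obtain ⟨C, hC⟩ := hF.bounded
    exact ⟨C, fun i η => by simpa using norm_torusCoeff_le (hC i) η⟩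
  | succ N ih =>
    obtain ⟨C, hC⟩ := ih (fun i => (sF i).torusD j) hF.2
    refine ⟨C, fun i η => ?_⟩
    have := hC i η
    rw [torusCoeff_torusD (sF i), norm_neg, norm_mul, Complex.norm_intCast, ← mul_assoc,
      ← pow_succ] at this
    exact this

end BddDeriv

/-- The largest coordinate controls the whole length, so derivatives in one direction at a time
suffice for decay in `η`. -/
theorem exists_bracket_le {n : ℕ} (η : Lattice n) :
    η = 0 ∨ ∃ j, bracket η ≤ (1 + n) * |(η j : ℝ)| := by
  by_cases h : η = 0
  · exact Or.inl h
  right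
  obtain ⟨i, hi⟩ := Function.ne_iff.1 h
  have : Nonempty (Fin n) := ⟨i⟩
  obtain ⟨j, hj⟩ := Finite.exists_max fun j => (η j).natAbs
  refine ⟨j, ?_⟩
  have h1 : latticeSize η ≤ n * (η j).natAbs := by
    simpa [latticeSize] using Finset.sum_le_card_nsmul Finset.univ (fun j => (η j).natAbs) _ fun i _ => hj i
  have h2 : 1 ≤ (η j).natAbs := by
    have := hj i
    simp only [Pi.zero_apply, ne_eq] at hi
    omega
  have h3 : 1 + latticeSize η ≤ (1 + n) * (η j).natAbs := by nlinarith
  have h4 : (1 : ℝ) + latticeSize η ≤ (1 + n) * ((η j).natAbs : ℕ) := by exact_mod_cast h3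
  rw [Nat.cast_natAbs] at h4
  rw [bracket]
  push_cast at h4
  exact h4

theorem exists_torusCoeff_le {n : ℕ} {ι : Type*} {F : ι → Torus n → ℂ}
    (sF : ∀ i, TorusSmooth (F i)) (h0 : ∃ C : ℝ, ∀ i x, ‖F i x‖ ≤ C)
    (hF : ∀ j N, BddDeriv j N F) (N : ℕ) :
    ∃ C : ℝ, 0 ≤ C ∧ ∀ i η, ‖torusCoeff (F i) η‖ ≤ C * (bracket η ^ N)⁻¹ := by
  obtain ⟨C, hC⟩ := h0
  choose D hD using fun j => (hF j N).torusCoeff_le sF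
  have hDs : 0 ≤ ∑ j, |D j| := Finset.sum_nonneg fun j _ => abs_nonneg _
  refine ⟨|C| + (1 + n) ^ N * ∑ j, |D j|, by positivity, fun i η => ?_⟩
  rw [← div_eq_mul_inv, le_div_iff₀ (pow_pos (bracket_pos η) N), mul_comm]
  rcases exists_bracket_le η with rfl | ⟨j, hj⟩
  · rw [bracket_zero, one_pow, one_mul]
    have h1 := (norm_torusCoeff_le (hC i) (0 : Lattice n)).trans (le_abs_self C)
    have : 0 ≤ (1 + n : ℝ) ^ N * ∑ j, |D j| := by positivity
    linarith
  · calc bracket η ^ N * ‖torusCoeff (F i) η‖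
        ≤ ((1 + n) * |(η j : ℝ)|) ^ N * ‖torusCoeff (F i) η‖ := by
          have := bracket_pos η
          gcongr
      _ = (1 + n) ^ N * (|(η j : ℝ)| ^ N * ‖torusCoeff (F i) η‖) := by rw [mul_pow]; ring
      _ ≤ (1 + n) ^ N * ∑ j, |D j| := by
          gcongr
          exact (hD j i η).trans ((le_abs_self _).trans
            (Finset.single_le_sum (f := fun j => |D j|) (fun _ _ => abs_nonneg _)
              (Finset.mem_univ j)))
      _ ≤ _ := by linarith [abs_nonneg C]

/-! ## Kernels of pseudo-differential operators -/

/-- Termwise integration of an absolutely convergent exponential series. It yields both the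
convolution rule for products and the matrix of `T_σ`. -/
theorem hasSum_mul_torusCoeff {n : ℕ} {c : Lattice n → ℂ} (hc : Summable fun p => ‖c p‖)
    (e : Lattice n → Lattice n) {G H : Torus n → ℂ} (hG : TorusSmooth G)
    (h : ∀ x, HasSum (fun p => c p * UnitAddTorus.mFourier (e p) x) (H x)) :
    HasSum (fun p => c p * torusCoeff G (e p)) (∫ x, H x * G x ∂(torusMeasure n)) := by
  obtain ⟨D, hD⟩ := hG.exists_bound
  have hint : ∀ p, TorusSmooth fun x => c p * (UnitAddTorus.mFourier (e p) x * G x) := fun p =>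
    ((torusSmooth_mFourier (e p)).mul hG).const_mul (c p)
  have hle : ∀ p x, ‖c p * (UnitAddTorus.mFourier (e p) x * G x)‖ ≤ ‖c p‖ * D := fun p x => by
    rw [norm_mul, norm_mul]
    refine mul_le_mul_of_nonneg_left ?_ (norm_nonneg _)
    exact (mul_le_of_le_one_left (norm_nonneg _) (norm_mFourier_apply _ x)).trans (hD x)
  have hs : Summable fun p =>
      ∫ x, ‖c p * (UnitAddTorus.mFourier (e p) x * G x)‖ ∂(torusMeasure n) := by
    refine Summable.of_nonneg_of_le (fun p => integral_nonneg fun x => norm_nonneg _) (fun p => ?_)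
      (hc.mul_right D)
    refine (integral_mono (hint p).integrable.norm (integrable_const _) (hle p)).trans ?_
    simp
  have key := hasSum_integral_of_summable_integral_norm (fun p => (hint p).integrable) hs
  have h1 : ∀ x, ∑' p, c p * (UnitAddTorus.mFourier (e p) x * G x) = H x * G x := fun x => by
    rw [← ((h x).mul_right (G x)).tsum_eq]
    simp only [mul_assoc]
  simp only [h1, integral_const_mul] at key
  exact key

theorem TorusSmooth.bddDeriv {n : ℕ} {F : Torus n → ℂ} (hF : TorusSmooth F) (j : Fin n) (N : ℕ) :
    BddDeriv j N fun _ : Unit => F := by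
  induction N generalizing F with
  | zero => exact hF.exists_bound.imp fun C hC _ => hC
  | succ N ih => exact ⟨hF.exists_bound.imp fun C hC _ => hC, ih (hF.torusD j)⟩

theorem TorusSmooth.summable_torusCoeff {n : ℕ} {F : Torus n → ℂ} (hF : TorusSmooth F) :
    Summable fun η => ‖torusCoeff F η‖ := by
  obtain ⟨C, -, hC⟩ := exists_torusCoeff_le (F := fun _ : Unit => F) (fun _ => hF)
    (hF.exists_bound.imp fun C hC _ => hC) (fun j N => hF.bddDeriv j N) (2 * n)
  exact Summable.of_nonneg_of_le (fun _ => norm_nonneg _) (fun η => hC () η)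
    ((summable_bracket n).mul_left C)

theorem mFourierCoeff_eq_torusCoeff {n : ℕ} (F : Torus n → ℂ) (η : Lattice n) :
    UnitAddTorus.mFourierCoeff F η = torusCoeff F (-η) := rfl

theorem TorusSmooth.hasSum_torusCoeff {n : ℕ} {F : Torus n → ℂ} (hF : TorusSmooth F)
    (k : Lattice n) (x : Torus n) :
    HasSum (fun p => torusCoeff F (k - p) * UnitAddTorus.mFourier (p - k) x) (F x) := by
  have hs : Summable (UnitAddTorus.mFourierCoeff (⟨F, hF.continuous⟩ : C(Torus n, ℂ))) := by
    refine Summable.of_norm ?_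
    simp only [mFourierCoeff_eq_torusCoeff]
    exact (Equiv.neg (Lattice n)).summable_iff.2 hF.summable_torusCoeff
  have h := UnitAddTorus.hasSum_mFourier_series_apply_of_summable hs x
  have h2 := (Equiv.subRight k).hasSum_iff.2 h
  refine h2.congr_fun fun p => ?_
  simp [mFourierCoeff_eq_torusCoeff]

theorem hasSum_torusCoeff_mul {n : ℕ} {F G : Torus n → ℂ} (hF : TorusSmooth F)
    (hG : TorusSmooth G) (k l : Lattice n) :
    HasSum (fun p => torusCoeff F (k - p) * torusCoeff G (p - l))
      (torusCoeff (fun x => F x * G x) (k - l)) := by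
  have hs : Summable fun p => ‖torusCoeff F (k - p)‖ :=
    (Equiv.subLeft k).summable_iff.2 hF.summable_torusCoeff
  have h := hasSum_mul_torusCoeff hs (fun p => p - k) ((torusSmooth_mFourier (k - l)).mul hG)
    (hF.hasSum_torusCoeff k)
  have h1 : ∀ p, torusCoeff (fun x => UnitAddTorus.mFourier (k - l) x * G x) (p - k) =
      torusCoeff G (p - l) := fun p => by
    simp only [torusCoeff, ← mul_assoc, ← UnitAddTorus.mFourier_add, sub_add_sub_cancel]
  have h2 : ∫ x, F x * (UnitAddTorus.mFourier (k - l) x * G x) ∂(torusMeasure n) =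
      torusCoeff (fun x => F x * G x) (k - l) := by
    simp only [torusCoeff, mul_left_comm]
  simp only [h1, h2] at h
  exact h

/-- For `η_j ≠ 0`, integration by parts multiplies the integral by `-η_j`, while the derivative of a
constant vanishes. -/
theorem torusCoeff_one {n : ℕ} (η : Lattice n) :
    torusCoeff (fun _ : Torus n => (1 : ℂ)) η = if η = 0 then 1 else 0 := by
  split_ifs with h
  · simp [torusCoeff, h, UnitAddTorus.mFourier_zero]
  · obtain ⟨j, hj⟩ := Function.ne_iff.1 h
    have h1 := torusCoeff_torusD (torusSmooth_const (n := n) 1) j η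
    have h2 : torusD j (fun _ : Torus n => (1 : ℂ)) = fun _ => 0 := by
      funext x; simp [torusD]
    rw [h2] at h1
    have h3 : (η j : ℂ) ≠ 0 := by exact_mod_cast hj
    have h4 : torusCoeff (fun _ : Torus n => (0 : ℂ)) η = 0 := by simp [torusCoeff]
    rw [h4, eq_comm, neg_eq_zero] at h1
    exact (mul_eq_zero.1 h1).resolve_left h3

theorem hasSum_pdoFun {n : ℕ} {σ : Lattice n → Torus n → ℂ} (hσ : ∀ k, TorusSmooth (σ k))
    {φ : Lattice n → ℂ} (hφ : IsRapidlyDecreasing φ) (k : Lattice n) :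
    HasSum (fun l => torusCoeff (σ k) (k - l) * φ l) (pdoFun σ φ k) := by
  have h := hasSum_mul_torusCoeff hφ.summable (fun l => -l)
    ((torusSmooth_mFourier k).mul (hσ k)) (H := latticeFourier φ) fun x => by
      simpa only [latticeFourier, mul_comm] using (hφ.summable_fourier x).hasSum
  have h1 : ∀ l, torusCoeff (fun x => UnitAddTorus.mFourier k x * σ k x) (-l) =
      torusCoeff (σ k) (k - l) := fun l => by
    simp only [torusCoeff, ← mul_assoc, ← UnitAddTorus.mFourier_add, neg_add_eq_sub]
  have h2 : ∫ x, latticeFourier φ x * (UnitAddTorus.mFourier k x * σ k x) ∂(torusMeasure n) =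
      pdoFun σ φ k := by
    simp only [pdoFun, mul_comm]
  simp only [h1, h2] at h
  simpa only [mul_comm] using h

theorem torusDFalling_const_mul {n : ℕ} {F : Torus n → ℂ} (c : ℂ) (hF : TorusSmooth F)
    (j : Fin n) (ℓ : ℕ) :
    torusDFalling j ℓ (fun x => c * F x) = fun x => c * torusDFalling j ℓ F x := by
  induction ℓ with
  | zero => rfl
  | succ ℓ ih =>
    funext x
    simp only [torusDFalling]
    rw [ih, torusD_const_mul c (hF.torusDFalling j ℓ)]
    ring

theorem torusDMulti_single {n : ℕ} (j : Fin n) (ℓ : ℕ) (F : Torus n → ℂ) :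
    torusDMulti (Pi.single j ℓ) F = torusDFalling j ℓ F := by
  rw [torusDMulti, composeAll_eq_of_forall_ne _ j fun i hi => by
    rw [Pi.single_eq_of_ne hi]; rfl, Pi.single_eq_same]

theorem torusDMulti_zero {n : ℕ} (F : Torus n → ℂ) : torusDMulti 0 F = F := by
  rw [torusDMulti, composeAll_eq_id (fun j => torusDFalling j ((0 : Fin n → ℕ) j)) fun i => rfl]
  rfl

section Family

variable {n : ℕ} {ι : Type*} {F : ι → Torus n → ℂ} {W : ι → ℝ}

theorem bounded_normalize {G : ι → Torus n → ℂ} (hW : ∀ i, 0 < W i)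
    (h : ∃ C : ℝ, ∀ i x, ‖G i x‖ ≤ C * W i) :
    ∃ C : ℝ, ∀ i x, ‖(((W i)⁻¹ : ℝ) : ℂ) * G i x‖ ≤ C := by
  obtain ⟨C, hC⟩ := h
  refine ⟨C, fun i x => ?_⟩
  rw [norm_mul, Complex.norm_real, Real.norm_of_nonneg (inv_nonneg.2 (hW i).le),
    inv_mul_le_iff₀ (hW i), mul_comm]
  exact hC i x

/-- Dividing by the weight, which is constant in `x`, reduces weighted estimates to uniform ones. -/
theorem bddDeriv_normalize (hW : ∀ i, 0 < W i) (sF : ∀ i, TorusSmooth (F i))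
    (h : ∀ j ℓ, ∃ C : ℝ, ∀ i x, ‖torusDFalling j ℓ (F i) x‖ ≤ C * W i) (j : Fin n) (N : ℕ) :
    BddDeriv j N fun i x => (((W i)⁻¹ : ℝ) : ℂ) * F i x :=
  bddDeriv_of_torusDFalling (F := fun i x => (((W i)⁻¹ : ℝ) : ℂ) * F i x)
    (fun i => (sF i).const_mul _) (fun ℓ => by
      simp only [torusDFalling_const_mul _ (sF _)]
      exact bounded_normalize hW (h j ℓ)) N 0

theorem exists_torusCoeff_le_mul (hW : ∀ i, 0 < W i) (sF : ∀ i, TorusSmooth (F i))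
    (h0 : ∃ C : ℝ, ∀ i x, ‖F i x‖ ≤ C * W i)
    (h : ∀ j ℓ, ∃ C : ℝ, ∀ i x, ‖torusDFalling j ℓ (F i) x‖ ≤ C * W i) (N : ℕ) :
    ∃ C : ℝ, 0 ≤ C ∧ ∀ i η, ‖torusCoeff (F i) η‖ ≤ C * W i * (bracket η ^ N)⁻¹ := by
  obtain ⟨C, hC, hb⟩ := exists_torusCoeff_le (fun i => (sF i).const_mul _)
    (bounded_normalize hW h0) (bddDeriv_normalize hW sF h) N
  refine ⟨C, hC, fun i η => ?_⟩
  have := hb i η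
  rw [torusCoeff_const_mul, norm_mul, Complex.norm_real,
    Real.norm_of_nonneg (inv_nonneg.2 (hW i).le), inv_mul_le_iff₀ (hW i)] at this
  linarith

theorem exists_torusCoeff_inv_le_mul (hW : ∀ i, 0 < W i) (sF : ∀ i, TorusSmooth (F i))
    (h : ∀ j ℓ, ∃ C : ℝ, ∀ i x, ‖torusDFalling j ℓ (F i) x‖ ≤ C * W i) {c : ℝ} (hc : 0 < c)
    (hl : ∀ i x, c * W i ≤ ‖F i x‖) (N : ℕ) :
    ∃ C : ℝ, 0 ≤ C ∧ ∀ i η,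
      ‖torusCoeff (fun x => (F i x)⁻¹) η‖ ≤ C * (W i)⁻¹ * (bracket η ^ N)⁻¹ := by
  have hl' : ∀ i x, c ≤ ‖(((W i)⁻¹ : ℝ) : ℂ) * F i x‖ := fun i x => by
    rw [norm_mul, Complex.norm_real, Real.norm_of_nonneg (inv_nonneg.2 (hW i).le),
      le_inv_mul_iff₀ (hW i), mul_comm]
    exact hl i x
  have sF' := fun i => (sF i).const_mul (((W i)⁻¹ : ℝ) : ℂ)
  have h0 : ∀ i x, (((W i)⁻¹ : ℝ) : ℂ) * F i x ≠ 0 := fun i x =>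
    norm_pos_iff.1 (hc.trans_le (hl' i x))
  obtain ⟨C, hC, hb⟩ := exists_torusCoeff_le (fun i => (sF' i).inv (h0 i))
    ⟨c⁻¹, fun i x => by rw [norm_inv]; exact inv_anti₀ hc (hl' i x)⟩
    (fun j N => (bddDeriv_normalize hW sF h j N).inv sF' hc hl') N
  refine ⟨C, hC, fun i η => ?_⟩
  have := hb i η
  simp only [mul_inv, ← Complex.ofReal_inv, inv_inv] at this
  rw [torusCoeff_const_mul, norm_mul, Complex.norm_real,
    Real.norm_of_nonneg (hW i).le] at this
  have h1 := hW i
  calc _ = (W i)⁻¹ * (W i * ‖torusCoeff (fun x => (F i x)⁻¹) η‖) := by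
        rw [inv_mul_cancel_left₀ h1.ne']
    _ ≤ (W i)⁻¹ * (C * (bracket η ^ N)⁻¹) := by gcongr
    _ = _ := by ring

end Family

/-! ## Symbols and their parametrices -/

section Symbol

variable {n : ℕ} {ρ m : ℝ} {Λ : Lattice n → ℝ} {σ : Lattice n → Torus n → ℂ}

theorem IsMSymbol.isTaylorSymbol (hσ : IsMSymbol ρ Λ m σ) : IsTaylorSymbol ρ Λ m σ := by
  have h := hσ.mem 0 fun _ => by simp
  simpa [latticeMonomial, latticeDiff_zero] using h

theorem IsTaylorSymbol.falling_le (hσ : IsTaylorSymbol ρ Λ m σ) (j : Fin n) (ℓ : ℕ) :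
    ∃ C : ℝ, ∀ k x, ‖torusDFalling j ℓ (σ k) x‖ ≤ C * Λ k ^ m := by
  obtain ⟨C, -, hC⟩ := hσ.bound 0 (Pi.single j ℓ)
  exact ⟨C, fun k x => by
    simpa [latticeDiff_zero, torusDMulti_single, multiLength_zero] using hC k x⟩

theorem IsTaylorSymbol.norm_le (hσ : IsTaylorSymbol ρ Λ m σ) :
    ∃ C : ℝ, ∀ k x, ‖σ k x‖ ≤ C * Λ k ^ m := by
  obtain ⟨C, -, hC⟩ := hσ.bound 0 0
  exact ⟨C, fun k x => by
    simpa [latticeDiff_zero, torusDMulti_zero, multiLength_zero] using hC k x⟩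

theorem IsTaylorSymbol.hasOrder (hΛ : IsModerate Λ) (hσ : IsTaylorSymbol ρ Λ m σ) :
    HasOrder Λ m fun k l => torusCoeff (σ k) (k - l) := fun N => by
  obtain ⟨C, hC, h⟩ := exists_torusCoeff_le_mul (fun k => Real.rpow_pos_of_pos (hΛ.pos k) m)
    hσ.smooth hσ.norm_le hσ.falling_le N
  exact ⟨C, hC, fun k l => h k (k - l)⟩

theorem IsTaylorSymbol.torusCoeff_step_le (hΛ : IsModerate Λ) (hσ : IsTaylorSymbol ρ Λ m σ)
    (j : Fin n) (N : ℕ) : ∃ C : ℝ, 0 ≤ C ∧ ∀ k η,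
      ‖torusCoeff (σ (k + Pi.single j 1)) η - torusCoeff (σ k) η‖ ≤
        C * Λ k ^ (m - ρ) * (bracket η ^ N)⁻¹ := by
  obtain ⟨C, hC, h⟩ := exists_torusCoeff_le_mul
    (F := fun k x => σ (k + Pi.single j 1) x - σ k x)
    (fun k => Real.rpow_pos_of_pos (hΛ.pos k) (m - ρ))
    (fun k => (hσ.smooth _).sub (hσ.smooth _))
    (by
      obtain ⟨C, -, hC⟩ := hσ.bound (Pi.single j 1) 0
      exact ⟨C, fun k x => by
        simpa [latticeDiff_single, torusDMulti_zero, multiLength_single] using hC k x⟩)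
    (fun i ℓ => by
      obtain ⟨C, -, hC⟩ := hσ.bound (Pi.single j 1) (Pi.single i ℓ)
      exact ⟨C, fun k x => by
        simpa [latticeDiff_single, torusDMulti_single, multiLength_single] using hC k x⟩) N
  refine ⟨C, hC, fun k η => ?_⟩
  rw [← torusCoeff_sub (hσ.smooth _) (hσ.smooth _)]
  exact h k η

/-- Sum the one-step differences along a lattice path from `k` to `p`. Moderateness compares
`Λ^{m-ρ}` along the path with its value at `k`, and the path length adds one power of `bracket (p -
k)`. -/
theorem IsTaylorSymbol.torusCoeff_sub_le (hΛ : IsModerate Λ) (hσ : IsTaylorSymbol ρ Λ m σ)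
    (N : ℕ) : ∃ (C : ℝ) (M : ℕ), 0 ≤ C ∧ ∀ k p η,
      ‖torusCoeff (σ p) η - torusCoeff (σ k) η‖ ≤
        C * Λ k ^ (m - ρ) * bracket (p - k) ^ M * (bracket η ^ N)⁻¹ := by
  choose C hC h using fun j => hσ.torusCoeff_step_le hΛ j N
  obtain ⟨D, M, hD, hM⟩ := hΛ.rpow_le (m - ρ)
  have hCs : 0 ≤ ∑ j, C j := Finset.sum_nonneg fun j _ => hC j
  refine ⟨(∑ j, C j) * D, M + 1, by positivity, fun k p η => ?_⟩
  have hb := bracket_pos (p - k)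
  have hη := bracket_pos η
  have hk := Real.rpow_pos_of_pos (hΛ.pos k) (m - ρ)
  have key := norm_sub_le_of_step (fun q => torusCoeff (σ q) η) k (latticeSize (p - k))
    ((∑ j, C j) * (D * Λ k ^ (m - ρ) * bracket (p - k) ^ M) * (bracket η ^ N)⁻¹)
    (fun q j hq => by
      have hq0 := Real.rpow_pos_of_pos (hΛ.pos q) (m - ρ)
      have hq1 := bracket_pos (q - k)
      refine (h j q η).trans ?_
      gcongr
      · exact Finset.single_le_sum (f := C) (fun i _ => hC i) (Finset.mem_univ j)
      · refine (hM k q).trans ?_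
        have : bracket (q - k) ≤ bracket (p - k) := by
          simp only [bracket]; gcongr
        gcongr) p le_rfl
  refine key.trans ?_
  have : (latticeSize (p - k) : ℝ) ≤ bracket (p - k) := by simp [bracket]
  calc _ ≤ bracket (p - k) *
        ((∑ j, C j) * (D * Λ k ^ (m - ρ) * bracket (p - k) ^ M) * (bracket η ^ N)⁻¹) := by
        gcongr
    _ = _ := by ring

/-- The kernel of the operator with symbol `1 / σ(k, x)`, cut off to `|k| ≥ R`. -/
def parametrixKernel (σ : Lattice n → Torus n → ℂ) (R : ℝ) (k p : Lattice n) : ℂ :=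
  if R ≤ latticeNorm k then torusCoeff (fun x => (σ k x)⁻¹) (k - p) else 0

theorem hasOrder_parametrixKernel (hΛ : IsModerate Λ) (hσ : IsTaylorSymbol ρ Λ m σ) {c R : ℝ}
    (hc : 0 < c) (hell : ∀ k, R ≤ latticeNorm k → ∀ x, c * Λ k ^ m ≤ ‖σ k x‖) :
    HasOrder Λ (-m) (parametrixKernel σ R) := fun N => by
  obtain ⟨C, hC, h⟩ := exists_torusCoeff_inv_le_mul
    (ι := {k : Lattice n // R ≤ latticeNorm k}) (F := fun k => σ k) (W := fun k => Λ k ^ m)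
    (fun k => Real.rpow_pos_of_pos (hΛ.pos k) m) (fun k => hσ.smooth k)
    (fun j ℓ => (hσ.falling_le j ℓ).imp fun C hC k => hC k) hc (fun k => hell k k.2) N
  refine ⟨C, hC, fun k p => ?_⟩
  rw [parametrixKernel, Real.rpow_neg (hΛ.pos k).le]
  split_ifs with hk
  · exact h ⟨k, hk⟩ (k - p)
  · have h1 := Real.rpow_pos_of_pos (hΛ.pos k) m
    have h2 := bracket_pos (k - p)
    rw [norm_zero]
    positivity

/-- The bracket is submultiplicative, so `N` powers of both factors combine into decay in `k - l`;
the other `2n` pay for the sum over `p`. -/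
theorem summable_norm_and_tsum_le {X : Lattice n → ℂ} {C : ℝ} {N : ℕ} {k l : Lattice n}
    (hC : 0 ≤ C)
    (h : ∀ p, ‖X p‖ ≤ C * (bracket (k - p) ^ (N + 2 * n))⁻¹ * (bracket (p - l) ^ N)⁻¹) :
    Summable X ∧ ‖∑' p, X p‖ ≤
      C * (∑' q : Lattice n, (bracket q ^ (2 * n))⁻¹) * (bracket (k - l) ^ N)⁻¹ := by
  have hle : ∀ p, ‖X p‖ ≤ C * (bracket (k - l) ^ N)⁻¹ * (bracket (k - p) ^ (2 * n))⁻¹ := fun p => by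
    have h1 := bracket_pos (k - p)
    have h2 := bracket_pos (p - l)
    have h3 := bracket_pos (k - l)
    have h4 : bracket (k - l) ≤ bracket (k - p) * bracket (p - l) := by
      simpa using bracket_add_le (k - p) (p - l)
    calc ‖X p‖ ≤ _ := h p
      _ = C * ((bracket (k - p) * bracket (p - l)) ^ N)⁻¹ * (bracket (k - p) ^ (2 * n))⁻¹ := by
        rw [mul_pow, pow_add]; field_simp
      _ ≤ _ := by gcongr
  have hs : Summable fun p => (bracket (k - p) ^ (2 * n))⁻¹ :=
    (Equiv.subLeft k).summable_iff.2 (summable_bracket n)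
  refine ⟨Summable.of_norm_bounded (hs.mul_left _) hle, ?_⟩
  refine (tsum_of_norm_bounded (hs.mul_left _).hasSum hle).trans (le_of_eq ?_)
  have ht : ∑' p, (bracket (k - p) ^ (2 * n))⁻¹ = ∑' q : Lattice n, (bracket q ^ (2 * n))⁻¹ :=
    (Equiv.subLeft k).tsum_eq fun q : Lattice n => (bracket q ^ (2 * n))⁻¹
  rw [tsum_mul_left, ht]
  ring

/-- Freeze `σ(p, ·)` at `p = k`: for `|k| ≥ R` the frozen product is the Fourier integral of `σ⁻¹σ =
1`, that is, the identity matrix. The error `X` has order `-m + (m - ρ)`. -/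
theorem exists_parametrix_remainder (hΛ : IsModerate Λ)
    (hσ : IsTaylorSymbol ρ Λ m σ) {c R : ℝ} (hc : 0 < c) (hR : 0 < R)
    (hell : ∀ k, R ≤ latticeNorm k → ∀ x, c * Λ k ^ m ≤ ‖σ k x‖) :
    ∃ S : Lattice n → Lattice n → ℂ, HasOrder Λ (-ρ) S ∧ ∀ k l,
      HasSum (fun p => parametrixKernel σ R k p * torusCoeff (σ p) (p - l))
        ((if k = l then 1 else 0) + S k l) := by
  set B := parametrixKernel σ R with hB
  have hBo := hasOrder_parametrixKernel hΛ hσ hc hell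
  set X : Lattice n → Lattice n → Lattice n → ℂ := fun k l p =>
    B k p * (torusCoeff (σ p) (p - l) - torusCoeff (σ k) (p - l)) with hX
  have hXle : ∀ N, ∃ C : ℝ, 0 ≤ C ∧ ∀ k l p, ‖X k l p‖ ≤
      C * Λ k ^ (-ρ) * (bracket (k - p) ^ (N + 2 * n))⁻¹ * (bracket (p - l) ^ N)⁻¹ := fun N => by
    obtain ⟨D, M, hD, hDM⟩ := hσ.torusCoeff_sub_le hΛ N
    -- `M` powers absorb the growth of the symbol difference; `N + 2n` remain for the summation over
    -- `p`.
    obtain ⟨C, hC, hCB⟩ := hBo (N + 2 * n + M)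
    refine ⟨C * D, by positivity, fun k l p => ?_⟩
    have h1 := hCB k p
    have h2 := hDM k p (p - l)
    have hb := bracket_pos (k - p)
    have hb2 := bracket_pos (p - l)
    have hk := hΛ.pos k
    rw [bracket_sub_comm p k] at h2
    rw [hX, norm_mul]
    calc _ ≤ (C * Λ k ^ (-m) * (bracket (k - p) ^ (N + 2 * n + M))⁻¹) *
          (D * Λ k ^ (m - ρ) * bracket (k - p) ^ M * (bracket (p - l) ^ N)⁻¹) := by
          gcongr
      _ = C * D * (Λ k ^ (-m) * Λ k ^ (m - ρ)) * (bracket (k - p) ^ (N + 2 * n))⁻¹ *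
          (bracket (p - l) ^ N)⁻¹ := by
          rw [pow_add _ (N + 2 * n)]; field_simp
      _ = _ := by
          rw [← Real.rpow_add hk]; ring_nf
  have hXs : ∀ k l, Summable (X k l) := fun k l => by
    obtain ⟨C, hC, h⟩ := hXle 0
    have hk := Real.rpow_pos_of_pos (hΛ.pos k) (-ρ)
    exact (summable_norm_and_tsum_le (by positivity) (h k l)).1
  -- Where the parametrix is cut off the product is zero, so the remainder must be minus the
  -- identity.
  refine ⟨fun k l => if R ≤ latticeNorm k then ∑' p, X k l p else -(if k = l then 1 else 0),
    fun N => ?_, fun k l => ?_⟩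
  · obtain ⟨C, hC, h⟩ := hXle N
    obtain ⟨D, M, hD, hDM⟩ := hΛ.rpow_le ρ
    set T := ∑' q : Lattice n, (bracket q ^ (2 * n))⁻¹ with hT
    have hT0 : 0 ≤ T := tsum_nonneg fun q => inv_nonneg.2 (pow_nonneg (bracket_pos q).le _)
    set E := D * Λ 0 ^ ρ * ((1 + n) * (1 + R)) ^ M with hE
    have hE0 : 0 ≤ E := by
      have := hΛ.pos 0
      positivity
    refine ⟨C * T + E, by positivity, fun k l => ?_⟩
    have hk := Real.rpow_pos_of_pos (hΛ.pos k) (-ρ)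
    have hb := bracket_pos (k - l)
    have hb0 := bracket_pos k
    have hΛ0 := hΛ.pos 0
    dsimp only
    split_ifs with hkR hkl
    · refine (summable_norm_and_tsum_le (by positivity) (h k l)).2.trans ?_
      rw [← hT]
      have : 0 ≤ E * Λ k ^ (-ρ) * (bracket (k - l) ^ N)⁻¹ := by positivity
      nlinarith
    -- On `|k| < R` the weight is bounded, so the entry `-1` is harmless: `1 ≤ E Λ(k)^{-ρ}`.
    · have h1 : Λ k ^ ρ ≤ E := by
        have := hDM 0 k
        rw [sub_zero] at this
        refine this.trans ?_
        have h3 := bracket_le_latticeNorm k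
        have h4 : bracket k ≤ (1 + n) * (1 + R) := h3.trans (by gcongr; exact (not_le.1 hkR).le)
        rw [hE]
        gcongr
      have h2 : Λ k ^ (-ρ) * Λ k ^ ρ = 1 := by rw [← Real.rpow_add (hΛ.pos k)]; simp
      rw [hkl, sub_self, bracket_zero, one_pow, inv_one, mul_one, norm_neg, norm_one, ← hkl]
      have h3 : 0 ≤ C * T * Λ k ^ (-ρ) := by positivity
      nlinarith
    · rw [neg_zero, norm_zero]
      positivity
  · by_cases hkR : R ≤ latticeNorm k
    · simp only [if_pos hkR]
      have h0 : ∀ x, σ k x ≠ 0 := fun x => norm_pos_iff.1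
        ((mul_pos hc (Real.rpow_pos_of_pos (hΛ.pos k) m)).trans_le (hell k hkR x))
      have h1 := hasSum_torusCoeff_mul ((hσ.smooth k).inv h0) (hσ.smooth k) k l
      simp only [inv_mul_cancel₀ (h0 _), torusCoeff_one, sub_eq_zero] at h1
      refine (h1.add (hXs k l).hasSum).congr_fun fun p => ?_
      simp only [hX, hB, parametrixKernel, if_pos hkR]
      ring
    · simp only [hB, parametrixKernel, if_neg hkR, zero_mul, add_neg_cancel]
      exact hasSum_zero

end Symbol

/-! ## Minimal and maximal operators -/

section Operators

variable {n : ℕ} {ρ m : ℝ} {Λ : Lattice n → ℝ} {σ : Lattice n → Torus n → ℂ}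

theorem sum_single_mem_schwartz (s : Finset (Lattice n)) (g : Lattice n → ℂ) :
    ∑ i ∈ s, lp.single 2 i (g i) ∈ schwartz n := by
  refine Submodule.sum_mem _ fun i _ N => ⟨‖g i‖ * (1 + latticeNorm i) ^ N, fun k => ?_⟩
  have hk : 0 < 1 + latticeNorm k := add_pos_of_pos_of_nonneg one_pos (Real.sqrt_nonneg _)
  have hi : 0 < 1 + latticeNorm i := add_pos_of_pos_of_nonneg one_pos (Real.sqrt_nonneg _)
  change ‖(lp.single 2 i (g i) : L2 n) k‖ ≤ _
  by_cases h : k = i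
  · subst h
    rw [lp.single_apply_self, mul_inv_cancel_right₀ (pow_pos hk N).ne']
  · rw [lp.single_apply_ne _ _ _ h, norm_zero]
    positivity

theorem single_mem_schwartz (i : Lattice n) (a : ℂ) : lp.single 2 i a ∈ schwartz n := by
  simpa using sum_single_mem_schwartz {i} fun _ => a

theorem dense_schwartz : Dense (schwartz n : Set (L2 n)) := fun f =>
  mem_closure_of_tendsto (lp.hasSum_single (by simp) f)
    (Eventually.of_forall fun s => sum_single_mem_schwartz s fun i => f i)

theorem pdo_apply (hσ : ∀ k, TorusSmooth (σ k)) (φ : (pdo σ hσ).domain) (k : Lattice n) :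
    pdo σ hσ φ k = pdoFun σ (fun l => φ.1 l) k := rfl

theorem IsTaylorSymbol.pdo_domain (hΛ : IsModerate Λ) (hσ : IsTaylorSymbol ρ Λ m σ) :
    (pdo σ hσ.smooth).domain = schwartz n := by
  refine le_antisymm (fun φ hφ => hφ.1) fun φ hφ => ⟨hφ, ?_⟩
  obtain ⟨u, hu⟩ := (hσ.hasOrder hΛ).isSobolev hΛ (IsRapidlyDecreasing.isSobolev hΛ m hφ)
    (hasSum_pdoFun hσ.smooth hφ)
  have : pdoFun σ (fun k => φ k) = u := funext fun k => by rw [hu]; simp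
  rw [this]
  exact lp.memℓp u

theorem IsTaylorSymbol.dense_pdo_domain (hΛ : IsModerate Λ) (hσ : IsTaylorSymbol ρ Λ m σ) :
    Dense ((pdo σ hσ.smooth).domain : Set (L2 n)) := by
  rw [hσ.pdo_domain hΛ]
  exact dense_schwartz

/-- Factors the operator as `Λ^m T` with `T` bounded, which makes the adjoint explicit on rapidly
decreasing `ψ`: it is `T^*(Λ^m ψ)`. -/
theorem IsTaylorSymbol.exists_bounded_factor (hΛ : IsModerate Λ) (hσ : IsTaylorSymbol ρ Λ m σ) :
    ∃ T : L2 n →L[ℂ] L2 n, ∀ (g : L2 n) k,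
      HasSum (fun l => torusCoeff (σ k) (k - l) * g l) (((Λ k ^ m : ℝ) : ℂ) * T g k) := by
  obtain ⟨T, hT⟩ := (hσ.hasOrder hΛ).exists_clm hΛ (-m) 0 (by ring)
  refine ⟨T, fun g k => ((hT g k).mul_left _).congr_fun fun l => ?_⟩
  rw [Real.rpow_zero, Complex.ofReal_one, mul_one, ← mul_assoc, ← mul_assoc,
    mul_comm ((Λ k ^ m : ℝ) : ℂ), rpow_neg_mul_rpow_cast (hΛ.pos k), one_mul]

theorem inner_adjoint_eq (hσ : ∀ k, TorusSmooth (σ k)) {T : L2 n →L[ℂ] L2 n}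
    (hT : ∀ (g : L2 n) k,
      HasSum (fun l => torusCoeff (σ k) (k - l) * g l) (((Λ k ^ m : ℝ) : ℂ) * T g k))
    {ψ v : L2 n} (hv : ∀ k, v k = ((Λ k ^ m : ℝ) : ℂ) * ψ k) (φ : (pdo σ hσ).domain) :
    inner ℂ (T.adjoint v) (φ : L2 n) = inner ℂ ψ (pdo σ hσ φ) := by
  rw [ContinuousLinearMap.adjoint_inner_left, lp.inner_eq_tsum, lp.inner_eq_tsum]
  refine tsum_congr fun k => ?_
  rw [pdo_apply, (hasSum_pdoFun hσ φ.2.1 k).unique (hT φ k), hv]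
  simp [RCLike.inner_apply]
  ring

theorem IsTaylorSymbol.schwartz_le_adjoint_domain (hΛ : IsModerate Λ)
    (hσ : IsTaylorSymbol ρ Λ m σ) :
    schwartz n ≤ (pdo σ hσ.smooth).adjoint.domain := fun ψ hψ => by
  obtain ⟨T, hT⟩ := hσ.exists_bounded_factor hΛ
  obtain ⟨v, hv⟩ := IsRapidlyDecreasing.isSobolev hΛ m hψ
  exact LinearPMap.mem_adjoint_domain_of_exists _
    ⟨T.adjoint v, inner_adjoint_eq hσ.smooth hT hv⟩

theorem IsTaylorSymbol.minimalGraph_le_maximalGraph (hΛ : IsModerate Λ)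
    (hσ : IsTaylorSymbol ρ Λ m σ) :
    minimalGraph σ hσ.smooth ≤ maximalGraph σ hσ.smooth := by
  rintro ⟨g, f⟩ ⟨φ, hg, hf⟩ ψ -
  have h1 := hg.inner (tendsto_const_nhds (x := (pdo σ hσ.smooth).adjoint ψ)) (𝕜 := ℂ)
  have h2 := hf.inner (tendsto_const_nhds (x := (ψ : L2 n))) (𝕜 := ℂ)
  refine tendsto_nhds_unique h1 (h2.congr fun j => ?_)
  exact (LinearPMap.adjoint_isFormalAdjoint (hσ.dense_pdo_domain hΛ)).symm (φ j) ψ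

/-- On the maximal domain the operator is given by its kernel. -/
theorem IsTaylorSymbol.hasSum_of_mem_maximalGraph (hΛ : IsModerate Λ)
    (hσ : IsTaylorSymbol ρ Λ m σ) {g f : L2 n} (h : (g, f) ∈ maximalGraph σ hσ.smooth)
    (k : Lattice n) : HasSum (fun l => torusCoeff (σ k) (k - l) * g l) (f k) := by
  obtain ⟨T, hT⟩ := hσ.exists_bounded_factor hΛ
  -- Testing against the unit vector at `k` isolates the `k`-th entry of `f`.
  have hψ := single_mem_schwartz k (1 : ℂ)
  have hv : ∀ l, (lp.single 2 k ((Λ k ^ m : ℝ) : ℂ) : L2 n) l =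
      ((Λ l ^ m : ℝ) : ℂ) * (lp.single 2 k (1 : ℂ) : L2 n) l := fun l => by
    by_cases hl : l = k
    · subst hl; simp
    · rw [lp.single_apply_ne _ _ _ hl, lp.single_apply_ne _ _ _ hl, mul_zero]
  have h1 := h ⟨_, hσ.schwartz_le_adjoint_domain hΛ hψ⟩ hψ
  rw [LinearPMap.adjoint_apply_eq (hσ.dense_pdo_domain hΛ) _
    (inner_adjoint_eq hσ.smooth hT hv)] at h1
  rw [ContinuousLinearMap.adjoint_inner_right, lp.inner_single_right, lp.inner_single_right] at h1
  simp only [RCLike.inner_apply, one_mul] at h1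
  have h2 := congrArg (starRingEnd ℂ) h1
  simp only [map_mul, Complex.conj_conj, Complex.conj_ofReal] at h2
  rw [← h2]
  exact hT g k

theorem clm_ext_single {S T : L2 n →L[ℂ] L2 n}
    (h : ∀ l, S (lp.single 2 l (1 : ℂ)) = T (lp.single 2 l (1 : ℂ))) : S = T := by
  refine ContinuousLinearMap.ext fun g => ?_
  have hs := lp.hasSum_single (by simp) g
  refine (hs.mapL S).unique ((hs.mapL T).congr_fun fun l => ?_)
  have : lp.single 2 l (g l) = g l • (lp.single 2 l (1 : ℂ) : L2 n) := by
    rw [← lp.single_smul, smul_eq_mul, mul_one]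
  rw [this, map_smul, map_smul, h]

theorem hasSum_mul_single (a : Lattice n → ℂ) (l : Lattice n) :
    HasSum (fun p => a p * (lp.single 2 l (1 : ℂ) : L2 n) p) (a l) := by
  have h := hasSum_single (f := fun p => a p * (lp.single 2 l (1 : ℂ) : L2 n) p) l fun p hp => by
    rw [lp.single_apply_ne _ _ _ hp, mul_zero]
  rwa [lp.single_apply_self, mul_one] at h

theorem HasOrder.mono (hΛ : IsModerate Λ) {s t : ℝ} (hst : s ≤ t) {K : Lattice n → Lattice n → ℂ}
    (hK : HasOrder Λ s K) : HasOrder Λ t K := fun N => by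
  obtain ⟨C, hC, h⟩ := hK N
  obtain ⟨D, hD, hDt⟩ := hΛ.rpow_le_rpow hst
  refine ⟨C * D, by positivity, fun k l => (h k l).trans ?_⟩
  have hb := bracket_pos (k - l)
  rw [mul_assoc C D]
  gcongr
  exact hDt k

/-- Applying the parametrix: `B(Ag) = g + Sg`. -/
theorem exists_parametrix_identity (hΛ : IsModerate Λ) (hρ : 0 < ρ)
    {A B S : Lattice n → Lattice n → ℂ} (hA : HasOrder Λ m A) (hB : HasOrder Λ (-m) B)
    (hS : HasOrder Λ (-ρ) S)
    (hBA : ∀ k l, HasSum (fun p => B k p * A p l) ((if k = l then 1 else 0) + S k l))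
    {g f : L2 n} (hf : ∀ k, HasSum (fun l => A k l * g l) (f k)) :
    ∃ b h : L2 n, (∀ k, HasSum (fun p => B k p * f p) (b k)) ∧
      (∀ k, HasSum (fun l => S k l * g l) (h k)) ∧ b = g + h := by
  obtain ⟨TA, hTA⟩ := hA.exists_clm hΛ (-m) 0 (by ring)
  obtain ⟨TB, hTB⟩ := hB.exists_clm hΛ 0 m (by ring)
  obtain ⟨TS, hTS⟩ := (hS.mono hΛ (neg_nonpos.2 hρ.le)).exists_clm hΛ 0 0 (by ring)
  simp only [Real.rpow_zero, Complex.ofReal_one, one_mul, mul_one] at hTA hTB hTS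
  have hTA' : ∀ k, TA g k = ((Λ k ^ (-m) : ℝ) : ℂ) * f k := fun k =>
    (hTA g k).unique (((hf k).mul_left _).congr_fun fun l => by ring)
  -- Associativity `B(Ag) = (BA)g` is not a formal rearrangement of series. With `Λ^{-m}` and `Λ^m`
  -- inserted in the middle both factors are bounded, so it is enough to compare on unit vectors.
  have hcomp : TB ∘L TA = ContinuousLinearMap.id ℂ (L2 n) + TS := clm_ext_single fun l => by
    refine lp.ext (funext fun k => ?_)
    have h1 : ∀ p, TA (lp.single 2 l 1) p = ((Λ p ^ (-m) : ℝ) : ℂ) * A p l := fun p =>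
      (hTA _ p).unique (hasSum_mul_single (fun l => ((Λ p ^ (-m) : ℝ) : ℂ) * A p l) l)
    have h2 : TS (lp.single 2 l 1) k = S k l :=
      (hTS _ k).unique (hasSum_mul_single (fun l => S k l) l)
    have h3 : TB (TA (lp.single 2 l 1)) k = (if k = l then 1 else 0) + S k l := by
      refine (hTB _ k).unique ((hBA k l).congr_fun fun p => ?_)
      rw [h1, mul_assoc, ← mul_assoc _ _ (A p l), mul_comm ((Λ p ^ m : ℝ) : ℂ),
        rpow_neg_mul_rpow_cast (hΛ.pos p), one_mul]
    have h4 : (lp.single 2 l (1 : ℂ) : L2 n) k = if k = l then 1 else 0 := by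
      rw [lp.single_apply, Pi.single_apply]
    calc TB (TA (lp.single 2 l 1)) k = (if k = l then 1 else 0) + S k l := h3
      _ = (lp.single 2 l (1 : ℂ) : L2 n) k + TS (lp.single 2 l 1) k := by rw [h2, h4]
  refine ⟨TB (TA g), TS g, fun k => (hTB _ k).congr_fun fun p => ?_, hTS g, ?_⟩
  · rw [hTA', mul_assoc, ← mul_assoc _ _ (f p), mul_comm ((Λ p ^ m : ℝ) : ℂ),
      rpow_neg_mul_rpow_cast (hΛ.pos p), one_mul]
  · exact congrArg (fun T : L2 n →L[ℂ] L2 n => T g) hcomp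

/-- Elliptic regularity: if `g` and `T_σ g` are in `ℓ²` then so is `Λ^m g`. -/
theorem IsTaylorSymbol.isSobolev_of_elliptic (hΛ : IsModerate Λ) (hρ : 0 < ρ)
    (hσ : IsTaylorSymbol ρ Λ m σ) (hell : IsMElliptic Λ m σ) {g f : L2 n}
    (hf : ∀ k, HasSum (fun l => torusCoeff (σ k) (k - l) * g l) (f k)) :
    IsSobolev Λ m g := by
  obtain ⟨c, R, hc, hR, hell⟩ := hell
  obtain ⟨S, hS, hBA⟩ := exists_parametrix_remainder hΛ hσ hc hR hell
  have hB := hasOrder_parametrixKernel hΛ hσ hc hell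
  obtain ⟨b, h, hb, hh, hbgh⟩ :=
    exists_parametrix_identity hΛ hρ (hσ.hasOrder hΛ) hB hS hBA hf
  have hg : (g : Lattice n → ℂ) = b - h := by
    rw [hbgh, lp.coeFn_add, add_sub_cancel_right]
  have hbm : IsSobolev Λ m b := by
    simpa using hB.isSobolev hΛ (isSobolev_zero Λ f) hb
  -- Bootstrap on `g = b - h`: `b = Bf` always has regularity `m`, while `h = Sg` is better than `g`
  -- by `ρ`.
  have step : ∀ i : ℕ, IsSobolev Λ (min m (i * ρ)) g := fun i => by
    induction i with
    | zero => exact (isSobolev_zero Λ g).mono hΛ (by simp)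
    | succ i ih =>
      have h1 := hS.isSobolev hΛ ih hh
      rw [hg]
      refine (hbm.mono hΛ (min_le_left _ _)).sub (h1.mono hΛ ?_)
      rw [sub_neg_eq_add, min_add]
      refine min_le_min (by linarith) (le_of_eq ?_)
      push_cast
      ring
  obtain ⟨i, hi⟩ := exists_nat_ge (m / ρ)
  have := step i
  rwa [min_eq_left ((div_le_iff₀ hρ).1 hi)] at this

/-- Here the weight is put on the other side, `T_σ = T Λ^m` with `T` bounded. Finite truncations of
`g` and of `u = Λ^m g` both converge in `ℓ²`, and `T` carries the latter to `f`. -/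
theorem IsTaylorSymbol.mem_minimalGraph (hΛ : IsModerate Λ) (hσ : IsTaylorSymbol ρ Λ m σ)
    {g f : L2 n} (hf : ∀ k, HasSum (fun l => torusCoeff (σ k) (k - l) * g l) (f k))
    (hg : IsSobolev Λ m g) : (g, f) ∈ minimalGraph σ hσ.smooth := by
  obtain ⟨u, hu⟩ := hg
  obtain ⟨T, hT⟩ := (hσ.hasOrder hΛ).exists_clm hΛ 0 (-m) (by ring)
  simp only [Real.rpow_zero, Complex.ofReal_one, one_mul] at hT
  obtain ⟨s, hs⟩ := exists_seq_tendsto (atTop : Filter (Finset (Lattice n)))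
  have hmul : ∀ (v w : L2 n) (k : Lattice n) (a : ℂ), (∀ l, v l = ((Λ l ^ m : ℝ) : ℂ) * w l) →
      HasSum (fun l => torusCoeff (σ k) (k - l) * w l) a → T v k = a := fun v w k a hvw ha =>
    (hT v k).unique (ha.congr_fun fun l => by
      rw [hvw, mul_assoc, ← mul_assoc _ _ (w l), rpow_neg_mul_rpow_cast (hΛ.pos l), one_mul])
  have hTu : T u = f := lp.ext (funext fun k => hmul u g k _ hu (hf k))
  have hmem : ∀ j, ∑ i ∈ s j, lp.single 2 i (g i) ∈ (pdo σ hσ.smooth).domain := fun j => by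
    rw [hσ.pdo_domain hΛ]
    exact sum_single_mem_schwartz _ _
  refine ⟨fun j => ⟨_, hmem j⟩, (lp.hasSum_single (by simp) g).comp hs, ?_⟩
  have hlim := ((lp.hasSum_single (by simp) u).mapL T).comp hs
  rw [hTu] at hlim
  refine hlim.congr fun j => ?_
  refine lp.ext (funext fun k => ?_)
  simp only [Function.comp_apply]
  rw [← map_sum]
  refine hmul _ (∑ i ∈ s j, lp.single 2 i (g i)) k _ (fun l => ?_)
    (hasSum_pdoFun hσ.smooth (hmem j).1 k)
  simp only [lp.coeFn_sum, Finset.sum_apply, Finset.mul_sum, lp.single_apply]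
  refine Finset.sum_congr rfl fun i _ => ?_
  by_cases hl : l = i
  · subst hl; simp [hu]
  · simp [Pi.single_eq_of_ne hl]

theorem IsTaylorSymbol.minimalGraph_eq_maximalGraph (hΛ : IsModerate Λ) (hρ : 0 < ρ)
    (hσ : IsTaylorSymbol ρ Λ m σ) (hell : IsMElliptic Λ m σ) :
    minimalGraph σ hσ.smooth = maximalGraph σ hσ.smooth :=
  le_antisymm (hσ.minimalGraph_le_maximalGraph hΛ) fun p hp => by
    have hf := hσ.hasSum_of_mem_maximalGraph hΛ (g := p.1) (f := p.2) hp
    exact hσ.mem_minimalGraph hΛ hf (hσ.isSobolev_of_elliptic hΛ hρ hell hf)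

/-- Single-valuedness: on the maximal graph `f` is computed from `g` by the matrix, so `g = 0`
forces `f = 0`. -/
theorem IsTaylorSymbol.graph_maximalOp (hΛ : IsModerate Λ) (hσ : IsTaylorSymbol ρ Λ m σ) :
    (maximalOp σ hσ.smooth).graph = maximalGraph σ hσ.smooth := by
  refine Submodule.toLinearPMap_graph_eq _ ?_
  rintro ⟨g, f⟩ hgf h0
  obtain rfl : g = 0 := h0
  refine lp.ext (funext fun k => ?_)
  refine (hσ.hasSum_of_mem_maximalGraph hΛ hgf k).unique ?_
  simp only [lp.coeFn_zero, Pi.zero_apply, mul_zero]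
  exact hasSum_zero

end Operators

end LatticePDO

end

/-- If `σ ∈ M^m_{ρ,Λ}(ℤⁿ × 𝕋ⁿ)` is `M`-elliptic then `T_{σ,0} = T_{σ,1}`. The first four clauses
say that all the operators are well defined: `T_σ` has domain `𝒮(ℤⁿ)`, its adjoint is defined on
`𝒮(ℤⁿ)`, and the defining relations of `T_{σ,0}` and `T_{σ,1}` are graphs of operators. -/
theorem mainTheorem4 (n : ℕ) (μ ρ m : ℝ) (Λ : LatticePDO.Lattice n → ℝ)
    (hΛ : LatticePDO.IsWeight μ Λ) (hρ : 0 < ρ) (hρμ : ρ ≤ 1 / μ)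
    (σ : LatticePDO.Lattice n → LatticePDO.Torus n → ℂ)
    (hσ : LatticePDO.IsMSymbol ρ Λ m σ) (hell : LatticePDO.IsMElliptic Λ m σ) :
    (LatticePDO.pdo σ hσ.smooth).domain = LatticePDO.schwartz n ∧
    LatticePDO.schwartz n ≤ (LatticePDO.pdo σ hσ.smooth).adjoint.domain ∧
    (LatticePDO.minimalOp σ hσ.smooth).graph = LatticePDO.minimalGraph σ hσ.smooth ∧
    (LatticePDO.maximalOp σ hσ.smooth).graph = LatticePDO.maximalGraph σ hσ.smooth ∧
    LatticePDO.minimalOp σ hσ.smooth = LatticePDO.maximalOp σ hσ.smooth := by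
  have hΛ' := hΛ.isModerate
  have hσ' := hσ.isTaylorSymbol
  have hgraph := hσ'.minimalGraph_eq_maximalGraph hΛ' hρ hell
  have hop : LatticePDO.minimalOp σ hσ.smooth = LatticePDO.maximalOp σ hσ.smooth :=
    congrArg Submodule.toLinearPMap hgraph
  refine ⟨hσ'.pdo_domain hΛ', hσ'.schwartz_le_adjoint_domain hΛ', ?_, hσ'.graph_maximalOp hΛ', hop⟩
  rw [hop, hσ'.graph_maximalOp hΛ', hgraph]
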